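/- Let $n\ge 1$, $1<p\le\infty$ and $f:\mathbb R^n\to\mathbb R$. A measurable $g:\mathbb R^n\to[0,\infty)$ is called a Sobolev metric gradient of $f$ if there is a set $N\subset\mathbb R^n$ of Lebesgue measure zero such that $$|f(x)-f(y)|\le |x-y|\,(g(x)+g(y))\qquad\text{for all }x,y\in\mathbb R^n\setminus N .$$ Let $M^{1,p}(\mathbb R^n)$ be the class of all $f\in L^p_{\rm loc}(\mathbb R^n)$ that have a Sobolev metric gradient in $L^p(\mathbb R^n)$. Let $$MQf(x)=\sup_{r>0}\frac1{|B(x,r)|}\int_{B(x,r)}\frac{|f(z)-f(x)|}{|z-x|}\,dz\in[0,\infty],$$ where $B(x,r)$ is the open ball, and let $MQ^{1,p}(\mathbb R^n)$ be the class of all $f\in L^p(\mathbb R^n)$ with $MQf\in L^p(\mathbb R^n)$. Let $W^{1,p}(\mathbb R^n)$ (resp. $W^{1,p}_{\rm loc}(\mathbb R^n)$) be the class of all $f\in L^p(\mathbb R^n)$ (resp. $f\in L^p_{\rm loc}(\mathbb R^n)$) whose first-order weak partial derivatives exist and belong to $L^p(\mathbb R^n)$ (resp. $L^p_{\rm loc}(\mathbb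 R^n)$). Then: 1. $f\in W^{1,p}(\mathbb R^n)$ if and only if $f\in L^p(\mathbb R^n)$ and $f$ has a Sobolev metric gradient in $L^p(\mathbb R^n)$; that is, $W^{1,p}(\mathbb R^n)=L^p(\mathbb R^n)\cap M^{1,p}(\mathbb R^n)$. 2. $f\in W^{1,p}_{\rm loc}(\mathbb R^n)$ if and only if $f\in L^p_{\rm loc}(\mathbb R^n)$ and $f$ has a Sobolev metric gradient in $L^p_{\rm loc}(\mathbb R^n)$. 3. $f\in MQ^{1,p}(\mathbb R^n)$ if and only if $f\in L^p(\mathbb R^n)$ and $f$ has a Sobolev metric gradient in $L^p(\mathbb R^n)$; that is, $MQ^{1,p}(\mathbb R^n)=L^p(\mathbb R^n)\cap M^{1,p}(\mathbb R^n)$. -/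

import Mathlib

open MeasureTheory Set
open scoped ENNReal ContDiff

/-- The class `L^p_loc(ℝⁿ)`: the function is in `L^p(K)` for each compact set `K`. -/
def MemLpLoc {n : ℕ} (f : EuclideanSpace ℝ (Fin n) → ℝ) (p : ℝ≥0∞) : Prop :=
  ∀ K : Set (EuclideanSpace ℝ (Fin n)), IsCompact K → MemLp f p (volume.restrict K)

/-- The function `h` is a weak `i`-th partial derivative of `f` on `ℝⁿ`: both are locally
integrable and `∫ f ∂ᵢφ = - ∫ h φ` for all smooth, compactly supported `φ`. -/
def HasWeakPartial {n : ℕ} (i : Fin n) (f h : EuclideanSpace ℝ (Fin n) → ℝ) : Prop :=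
  LocallyIntegrable f volume ∧ LocallyIntegrable h volume ∧
    ∀ φ : EuclideanSpace ℝ (Fin n) → ℝ, ContDiff ℝ ∞ φ → HasCompactSupport φ →
      ∫ x, f x * fderiv ℝ φ x (EuclideanSpace.single i (1 : ℝ)) = - ∫ x, h x * φ x

/-- The Sobolev space `W^{1,p}(ℝⁿ)`. -/
def MemSobolevW {n : ℕ} (f : EuclideanSpace ℝ (Fin n) → ℝ) (p : ℝ≥0∞) : Prop :=
  MemLp f p volume ∧
    ∀ i : Fin n, ∃ h : EuclideanSpace ℝ (Fin n) → ℝ, MemLp h p volume ∧ HasWeakPartial i f h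

/-- The local Sobolev space `W^{1,p}_loc(ℝⁿ)`. -/
def MemSobolevWLoc {n : ℕ} (f : EuclideanSpace ℝ (Fin n) → ℝ) (p : ℝ≥0∞) : Prop :=
  MemLpLoc f p ∧
    ∀ i : Fin n, ∃ h : EuclideanSpace ℝ (Fin n) → ℝ, MemLpLoc h p ∧ HasWeakPartial i f h

/-- The average `M_r Q f(x)` over the open ball `B(x,r)` of the difference quotients
`|f(z) - f(x)| / |z - x|`, with values in `[0,∞]`. -/
noncomputable def meanQuotient {n : ℕ} (f : EuclideanSpace ℝ (Fin n) → ℝ) (r : ℝ)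
    (x : EuclideanSpace ℝ (Fin n)) : ℝ≥0∞ :=
  (volume (Metric.ball x r))⁻¹ * ∫⁻ z in Metric.ball x r, ‖f z - f x‖ₑ / ‖z - x‖ₑ

/-- The maximal mean difference quotient `MQ f(x)`, with values in `[0,∞]`. -/
noncomputable def maximalMeanQuotient {n : ℕ} (f : EuclideanSpace ℝ (Fin n) → ℝ)
    (x : EuclideanSpace ℝ (Fin n)) : ℝ≥0∞ :=
  ⨆ (r : ℝ) (_ : 0 < r), meanQuotient f r x

/-- The class `MQ^{1,p}(ℝⁿ)`. -/
def MemMQ {n : ℕ} (f : EuclideanSpace ℝ (Fin n) → ℝ) (p : ℝ≥0∞) : Prop :=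
  MemLp f p volume ∧ MemLp (maximalMeanQuotient f) p volume

/-- The function `g` is a Sobolev metric gradient of `f`: it is nonnegative, measurable, and
`|f(x) - f(y)| ≤ |x - y| (g(x) + g(y))` for all `x`, `y` outside a set of measure zero. -/
def IsSobolevMetricGradient {n : ℕ} (f g : EuclideanSpace ℝ (Fin n) → ℝ) : Prop :=
  (∀ x, 0 ≤ g x) ∧ AEStronglyMeasurable g volume ∧
    ∃ N : Set (EuclideanSpace ℝ (Fin n)), volume N = 0 ∧
      ∀ x ∉ N, ∀ y ∉ N, |f x - f y| ≤ ‖x - y‖ * (g x + g y)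

/-- The Hajłasz class `M^{1,p}(ℝⁿ)`: functions in `L^p_loc` with a Sobolev metric gradient
in `L^p`. -/
def MemHajlasz {n : ℕ} (f : EuclideanSpace ℝ (Fin n) → ℝ) (p : ℝ≥0∞) : Prop :=
  MemLpLoc f p ∧
    ∃ g : EuclideanSpace ℝ (Fin n) → ℝ, IsSobolevMetricGradient f g ∧ MemLp g p volume

/-- The local Hajłasz class: functions in `L^p_loc` with a Sobolev metric gradient
in `L^p_loc`. -/
def MemHajlaszLoc {n : ℕ} (f : EuclideanSpace ℝ (Fin n) → ℝ) (p : ℝ≥0∞) : Prop :=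
  MemLpLoc f p ∧
    ∃ g : EuclideanSpace ℝ (Fin n) → ℝ, IsSobolevMetricGradient f g ∧ MemLpLoc g p

/-!
Write `M u` for the Hardy–Littlewood maximal function. Two estimates of the mean difference
quotient `M_r Q f` over `B(x, r)` carry the proof.

* From below: comparing `f x` and `f y` with the values of `f` on the ball with diameter from `x`
  to `y` gives `|f x - f y| ≤ 2ⁿ |x - y| (M_r Q f x + M_r Q f y)` with `r = |x - y|`, for every
  measurable `f` (`enorm_sub_le_meanQuotient`). Hence `2ⁿ MQ f` is a Sobolev metric gradient of `f`
  wherever it is finite.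
* From above: for `C¹` functions, the fundamental theorem of calculus on segments and a change of
  variables give `M_r Q φ x ≤ M |∇φ| x`, using radii at most `r` only
  (`meanQuotient_le_maximalAverage_fderiv`).

Together they show `|φ x - φ y| ≤ 2ⁿ |x - y| (M |∇φ| x + M |∇φ| y)` for smooth `φ`. Applied to
mollifications, for which `M (u * ρ) ≤ (M u) * ρ`, this passes to the limit almost everywhere and
holds for all `f` with weak derivatives (`exists_null_enorm_sub_le_maximalAverage`). Radii at most
`1` suffice, because `|f|` itself controls `|f x - f y|` when `|x - y| ≥ 1`; so the argument is
local and covers both Sobolev classes. The maximal theorem (`memLp_maximalAverage`), proved with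
the Vitali covering lemma and the layer cake formula, puts the gradient in `L^p`; this is where
`p > 1` is needed. It also gives the last part of the claim, since a metric gradient `g` satisfies
`MQ f ≤ M g + g` almost everywhere (`ae_maximalMeanQuotient_le`).

Conversely, let `g` be a Sobolev metric gradient of `f`. Passing to the limit in difference
quotients gives `|∫ f ∂ᵢφ| ≤ 2 ∫ g |φ|` for test functions `φ`. A functional with such a bound is
integration against some `h` with `|h| ≤ 2 g` (`exists_eq_integral_of_abs_le`), by the
Hahn–Banach and Riesz theorems in a weighted `L²` space. So weak derivatives exist and inherit
the integrability of `g`, for all `p` at once and without weak compactness in `L^p`.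
-/

/-! ### Averages over balls and the Hardy–Littlewood maximal function -/

section MaximalAverage

variable {E : Type*} [NormedAddCommGroup E] [MeasurableSpace E] (μ : Measure E)

/-- The average of `u` over the open ball `B(x, r)`; it is `∞ * 0 = 0` when `r ≤ 0`. -/
noncomputable def ballAverage (u : E → ℝ≥0∞) (r : ℝ) (x : E) : ℝ≥0∞ :=
  (μ (Metric.ball x r))⁻¹ * ∫⁻ z in Metric.ball x r, u z ∂μ

/-- The maximal function of `u` with radii restricted to the set `S`. The choice `S = Ioi 0` is
the Hardy–Littlewood maximal function; bounded sets `S` give local versions of it. -/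
noncomputable def maximalAverage (S : Set ℝ) (u : E → ℝ≥0∞) (x : E) : ℝ≥0∞ :=
  ⨆ r ∈ S, ballAverage μ u r x

variable {μ}

lemma ballAverage_le_maximalAverage {S : Set ℝ} {r : ℝ} (hr : r ∈ S) (u : E → ℝ≥0∞) (x : E) :
    ballAverage μ u r x ≤ maximalAverage μ S u x :=
  le_iSup₂ (f := fun r _ => ballAverage μ u r x) r hr

lemma maximalAverage_mono_set {S T : Set ℝ} (h : S ⊆ T) (u : E → ℝ≥0∞) (x : E) :
    maximalAverage μ S u x ≤ maximalAverage μ T u x :=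
  biSup_mono h

lemma maximalAverage_mono {S : Set ℝ} {u v : E → ℝ≥0∞} (h : ∀ x, u x ≤ v x) (x : E) :
    maximalAverage μ S u x ≤ maximalAverage μ S v x :=
  iSup₂_mono fun _ _ => mul_le_mul_right (lintegral_mono h) _

lemma ballAverage_mono_ae {u v : E → ℝ≥0∞} (h : ∀ᵐ z ∂μ, u z ≤ v z) (r : ℝ) (x : E) :
    ballAverage μ u r x ≤ ballAverage μ v r x :=
  mul_le_mul_right (lintegral_mono_ae (ae_restrict_of_ae h)) _

lemma ballAverage_le_of_ae_le {u : E → ℝ≥0∞} {c : ℝ≥0∞} (h : ∀ᵐ z ∂μ, u z ≤ c) (r : ℝ) (x : E) :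
    ballAverage μ u r x ≤ c := by
  calc ballAverage μ u r x ≤ ballAverage μ (fun _ => c) r x := ballAverage_mono_ae h r x
    _ = ((μ (Metric.ball x r))⁻¹ * μ (Metric.ball x r)) * c := by
        simp only [ballAverage, lintegral_const, Measure.restrict_apply_univ]
        rw [mul_assoc, mul_comm c]
    _ ≤ 1 * c := by gcongr; exact ENNReal.inv_mul_le_one _
    _ = c := one_mul c

lemma ballAverage_add_const_le {u : E → ℝ≥0∞} (c : ℝ≥0∞) (r : ℝ) (x : E) :
    ballAverage μ (fun z => u z + c) r x ≤ ballAverage μ u r x + c := by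
  calc ballAverage μ (fun z => u z + c) r x
      = ballAverage μ u r x + ballAverage μ (fun _ => c) r x := by
        simp only [ballAverage]
        rw [lintegral_add_right _ measurable_const, mul_add]
    _ ≤ _ := by
        gcongr
        exact ballAverage_le_of_ae_le (Filter.Eventually.of_forall fun _ => le_rfl) r x

/-- Any integral over an open ball is approximated by integrals over slightly smaller balls. -/
lemma exists_lt_setLIntegral_ball_sub {u : E → ℝ≥0∞} {a c : ℝ≥0∞} {r : ℝ} {x : E}
    (h : a < c * ∫⁻ z in Metric.ball x r, u z ∂μ) :
    ∃ δ > 0, a < c * ∫⁻ z in Metric.ball x (r - δ), u z ∂μ := by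
  have hU : Metric.ball x r = ⋃ k : ℕ, Metric.ball x (r - 1 / ((k : ℝ) + 1)) := by
    ext y
    simp only [Metric.mem_ball, mem_iUnion]
    constructor
    · intro hy
      obtain ⟨k, hk⟩ := exists_nat_one_div_lt (sub_pos.2 hy)
      exact ⟨k, by linarith⟩
    · rintro ⟨k, hk⟩
      have : (0 : ℝ) < 1 / ((k : ℝ) + 1) := by positivity
      linarith
  have hmono : Monotone fun k : ℕ => Metric.ball x (r - 1 / ((k : ℝ) + 1)) := by
    intro k l hkl
    apply Metric.ball_subset_ball
    have : 1 / ((l : ℝ) + 1) ≤ 1 / ((k : ℝ) + 1) := by gcongr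
    linarith
  rw [hU, setLIntegral_iUnion_of_directed _ hmono.directed_le, ENNReal.mul_iSup] at h
  obtain ⟨k, hk⟩ := lt_iSup_iff.1 h
  exact ⟨1 / ((k : ℝ) + 1), by positivity, hk⟩

/-- By left continuity in the radius, rational radii suffice. -/
lemma maximalAverage_eq_iSup_rat (u : E → ℝ≥0∞) (x : E) :
    maximalAverage μ (Ioi 0) u x = ⨆ q : ℚ, ballAverage μ u q x := by
  apply le_antisymm
  · refine iSup₂_le fun r hr => le_of_forall_lt fun a ha => ?_
    obtain ⟨δ, hδ, h⟩ := exists_lt_setLIntegral_ball_sub ha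
    obtain ⟨q, hq, hq'⟩ := exists_rat_btwn (sub_lt_self r hδ)
    refine h.trans_le (le_trans ?_ (le_iSup (fun q : ℚ => ballAverage μ u q x) q))
    rw [ballAverage]
    gcongr
  · refine iSup_le fun q => ?_
    rcases le_or_gt (q : ℝ) 0 with hq | hq
    · simp [ballAverage, Metric.ball_eq_empty.2 hq]
    · exact ballAverage_le_maximalAverage (mem_Ioi.2 hq) u x

variable [BorelSpace E] [μ.IsAddHaarMeasure]

lemma lowerSemicontinuous_ballAverage (u : E → ℝ≥0∞) (r : ℝ) :
    LowerSemicontinuous (ballAverage μ u r) := by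
  intro x a ha
  obtain ⟨δ, hδ, h⟩ := exists_lt_setLIntegral_ball_sub ha
  filter_upwards [Metric.ball_mem_nhds x hδ] with y hy
  rw [ballAverage, Measure.addHaar_ball_center, ← Measure.addHaar_ball_center μ x]
  refine h.trans_le ?_
  gcongr
  intro z hz
  rw [Metric.mem_ball] at *
  calc dist z y ≤ dist z x + dist y x := dist_triangle_right _ _ _
    _ < r := by linarith

lemma measurable_maximalAverage (S : Set ℝ) (u : E → ℝ≥0∞) :
    Measurable (maximalAverage μ S u) := by
  have : LowerSemicontinuous (maximalAverage μ S u) :=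
    lowerSemicontinuous_biSup fun r _ => lowerSemicontinuous_ballAverage u r
  exact this.measurable

variable [NormedSpace ℝ E] [FiniteDimensional ℝ E]

/-- The weak type `(1, 1)` estimate for bounded radii, by the Vitali covering lemma. -/
lemma mul_measure_lt_maximalAverage_Ioc_le (R : ℝ) (u : E → ℝ≥0∞) (a : ℝ≥0∞) :
    a * μ {x | a < maximalAverage μ (Ioc 0 R) u x} ≤
      ENNReal.ofReal (5 ^ Module.finrank ℝ E) * ∫⁻ x, u x ∂μ := by
  set A := {x | a < maximalAverage μ (Ioc 0 R) u x} with hA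
  have hex : ∀ x, x ∈ A → ∃ r ∈ Ioc 0 R, a < ballAverage μ u r x := by
    intro x hx
    simpa only [hA, mem_ofPred_eq, maximalAverage, lt_iSup_iff, exists_prop] using hx
  choose! ρ hρ hρa using hex
  obtain ⟨v, hvA, hdisj, hcov⟩ := Vitali.exists_disjoint_subfamily_covering_enlargement_closedBall
    A id ρ R (fun x hx => (hρ x hx).2) 5 (by norm_num)
  have hcount : v.Countable := by
    refine hdisj.countable_of_nonempty_interior fun x hx => ?_
    have := (hρ x (hvA hx)).1
    rw [interior_closedBall _ this.ne']
    exact ⟨x, Metric.mem_ball_self this⟩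
  have hsub : A ⊆ ⋃ b ∈ v, Metric.closedBall b (5 * ρ b) := by
    intro x hx
    obtain ⟨b, hb, hxb⟩ := hcov x hx
    exact mem_iUnion₂.2 ⟨b, hb, hxb (Metric.mem_closedBall_self (hρ x hx).1.le)⟩
  have hball : ∀ b ∈ v, a * μ (Metric.closedBall b (5 * ρ b)) ≤
      ENNReal.ofReal (5 ^ Module.finrank ℝ E) * ∫⁻ z in Metric.ball b (ρ b), u z ∂μ := by
    intro b hb
    have hpos := (hρ b (hvA hb)).1
    have h1 := hρa b (hvA hb)
    rw [Measure.addHaar_closedBall μ b (by positivity), mul_pow, ENNReal.ofReal_mul (by positivity),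
      mul_assoc, ← Measure.addHaar_ball_of_pos μ b hpos, mul_left_comm]
    gcongr
    have hne : μ (Metric.ball b (ρ b)) ≠ 0 := (Metric.measure_ball_pos μ b hpos).ne'
    rw [ballAverage, mul_comm, ← div_eq_mul_inv] at h1
    exact ENNReal.mul_le_of_le_div h1.le
  have hdisj' : v.PairwiseDisjoint fun b => Metric.ball b (ρ b) :=
    hdisj.mono fun b => Metric.ball_subset_closedBall
  calc a * μ A ≤ a * ∑' b : v, μ (Metric.closedBall (b : E) (5 * ρ b)) := by
        gcongr
        exact (measure_mono hsub).trans (measure_biUnion_le μ hcount _)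
    _ = ∑' b : v, a * μ (Metric.closedBall (b : E) (5 * ρ b)) := ENNReal.tsum_mul_left.symm
    _ ≤ ∑' b : v, ENNReal.ofReal (5 ^ Module.finrank ℝ E) *
          ∫⁻ z in Metric.ball (b : E) (ρ b), u z ∂μ :=
        ENNReal.tsum_le_tsum fun b => hball b b.2
    _ = ENNReal.ofReal (5 ^ Module.finrank ℝ E) *
          ∫⁻ z in ⋃ b ∈ v, Metric.ball b (ρ b), u z ∂μ := by
        rw [ENNReal.tsum_mul_left,
          lintegral_biUnion hcount (fun _ _ => measurableSet_ball) hdisj']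
    _ ≤ _ := by gcongr; exact Measure.restrict_le_self

/-- The weak type `(1, 1)` estimate for the Hardy–Littlewood maximal function. -/
lemma mul_measure_lt_maximalAverage_le (u : E → ℝ≥0∞) (a : ℝ≥0∞) :
    a * μ {x | a < maximalAverage μ (Ioi 0) u x} ≤
      ENNReal.ofReal (5 ^ Module.finrank ℝ E) * ∫⁻ x, u x ∂μ := by
  have hU : {x | a < maximalAverage μ (Ioi 0) u x} =
      ⋃ k : ℕ, {x | a < maximalAverage μ (Ioc 0 (k : ℝ)) u x} := by
    ext x
    simp only [mem_ofPred_eq, mem_iUnion, maximalAverage, lt_iSup_iff, exists_prop, mem_Ioi,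
      mem_Ioc]
    constructor
    · rintro ⟨r, hr, h⟩
      obtain ⟨k, hk⟩ := exists_nat_ge r
      exact ⟨k, r, ⟨hr, hk⟩, h⟩
    · rintro ⟨k, r, hr, h⟩
      exact ⟨r, hr.1, h⟩
  have hmono : Monotone fun k : ℕ => {x | a < maximalAverage μ (Ioc 0 (k : ℝ)) u x} := by
    intro k l hkl x hx
    have hsub : Ioc (0 : ℝ) k ⊆ Ioc 0 l := Ioc_subset_Ioc_right (by exact_mod_cast hkl)
    exact lt_of_lt_of_le hx (maximalAverage_mono_set hsub u x)
  rw [hU, hmono.measure_iUnion, ENNReal.mul_iSup]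
  exact iSup_le fun k => mul_measure_lt_maximalAverage_Ioc_le k u a

/-- Only the part of `u` above height `a / 2` matters at level `a`. -/
lemma mul_measure_lt_maximalAverage_le_setLIntegral (u : E → ℝ≥0∞) (hu : Measurable u) (a : ℝ≥0∞) :
    a * μ {x | a < maximalAverage μ (Ioi 0) u x} ≤
      2 * ENNReal.ofReal (5 ^ Module.finrank ℝ E) * ∫⁻ x in {x | a < 2 * u x}, u x ∂μ := by
  have hms : MeasurableSet {x | a < 2 * u x} := measurableSet_lt measurable_const (hu.const_mul 2)
  -- `M u ≤ M v + a / 2`, so that `M u > a` forces `M v > a / 2`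
  set v := {x | a < 2 * u x}.indicator u with hv
  have hle : ∀ x, u x ≤ v x + a / 2 := by
    intro x
    by_cases hx : a < 2 * u x
    · rw [hv, indicator_of_mem (by exact hx)]; exact le_self_add
    · rw [hv, indicator_of_notMem (by exact hx), zero_add,
        ENNReal.le_div_iff_mul_le (by simp) (by simp), mul_comm]
      exact not_lt.1 hx
  have hsub : {x | a < maximalAverage μ (Ioi 0) u x} ⊆
      {x | a / 2 < maximalAverage μ (Ioi 0) v x} := by
    intro x hx
    have h1 : maximalAverage μ (Ioi 0) u x ≤ maximalAverage μ (Ioi 0) v x + a / 2 := by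
      refine (maximalAverage_mono hle x).trans (iSup₂_le fun r hr => ?_)
      exact (ballAverage_add_const_le _ _ _).trans
        (by gcongr; exact ballAverage_le_maximalAverage hr v x)
    by_contra hcon
    have hcon : maximalAverage μ (Ioi 0) v x ≤ a / 2 := not_lt.1 hcon
    have : maximalAverage μ (Ioi 0) u x ≤ a :=
      h1.trans ((add_le_add_left hcon _).trans_eq (ENNReal.add_halves a))
    exact absurd hx (not_lt.2 this)
  calc a * μ {x | a < maximalAverage μ (Ioi 0) u x}
      ≤ a * μ {x | a / 2 < maximalAverage μ (Ioi 0) v x} := by gcongr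
    _ = 2 * (a / 2 * μ {x | a / 2 < maximalAverage μ (Ioi 0) v x}) := by
        rw [← mul_assoc, ENNReal.mul_div_cancel (by simp) (by simp)]
    _ ≤ 2 * (ENNReal.ofReal (5 ^ Module.finrank ℝ E) * ∫⁻ x, v x ∂μ) :=
        mul_le_mul_right (mul_measure_lt_maximalAverage_le v _) 2
    _ = _ := by rw [hv, lintegral_indicator hms, mul_assoc]

/-- The layer cake formula for a power of a single extended nonnegative real number. -/
lemma lintegral_ofReal_rpow_indicator {q : ℝ} (hq : 0 < q) (y : ℝ≥0∞) :
    ∫⁻ t in Ioi (0 : ℝ), {t : ℝ | ENNReal.ofReal t < y}.indicator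
      (fun t => ENNReal.ofReal (t ^ (q - 1))) t = ENNReal.ofReal q⁻¹ * y ^ q := by
  have hms : ∀ y : ℝ≥0∞, MeasurableSet {t : ℝ | ENNReal.ofReal t < y} := fun y =>
    measurableSet_lt ENNReal.measurable_ofReal measurable_const
  have hfin : ∀ b : ℝ, 0 ≤ b → ∫⁻ t in Ioi (0 : ℝ),
      {t : ℝ | ENNReal.ofReal t < ENNReal.ofReal b}.indicator
        (fun t => ENNReal.ofReal (t ^ (q - 1))) t = ENNReal.ofReal q⁻¹ * ENNReal.ofReal b ^ q := by
    intro b hb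
    have hset : {t : ℝ | ENNReal.ofReal t < ENNReal.ofReal b} ∩ Ioi 0 = Ioo 0 b := by
      ext t
      simp only [mem_inter_iff, mem_ofPred_eq, mem_Ioi, mem_Ioo]
      constructor
      · rintro ⟨h, ht⟩
        exact ⟨ht, (ENNReal.ofReal_lt_ofReal_iff_of_nonneg ht.le).1 h⟩
      · rintro ⟨ht, h⟩
        exact ⟨(ENNReal.ofReal_lt_ofReal_iff_of_nonneg ht.le).2 h, ht⟩
    have hint : IntervalIntegrable (fun t : ℝ => t ^ (q - 1)) volume 0 b :=
      intervalIntegral.intervalIntegrable_rpow' (by linarith)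
    rw [lintegral_indicator (hms _), Measure.restrict_restrict (hms _), hset,
      setLIntegral_congr Ioo_ae_eq_Ioc, ← ofReal_integral_eq_lintegral_ofReal
        ((intervalIntegrable_iff_integrableOn_Ioc_of_le hb).1 hint),
      ← intervalIntegral.integral_of_le hb, integral_rpow (Or.inl (by linarith)), sub_add_cancel,
      Real.zero_rpow hq.ne', sub_zero, ENNReal.ofReal_rpow_of_nonneg hb hq.le,
      ← ENNReal.ofReal_mul (by positivity), div_eq_inv_mul]
    filter_upwards [ae_restrict_mem measurableSet_Ioc] with t ht
    exact Real.rpow_nonneg ht.1.le _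
  by_cases hy : y = ⊤
  · subst hy
    rw [ENNReal.top_rpow_of_pos hq, ENNReal.mul_top (by simpa using hq)]
    refine ENNReal.eq_top_of_forall_nnreal_le fun c => ?_
    have h0 := hfin ((q * c) ^ q⁻¹) (by positivity)
    rw [ENNReal.ofReal_rpow_of_nonneg (by positivity) hq.le, ← Real.rpow_mul (by positivity),
      inv_mul_cancel₀ hq.ne', Real.rpow_one, ← ENNReal.ofReal_mul (by positivity),
      inv_mul_cancel_left₀ hq.ne', ENNReal.ofReal_coe_nnreal] at h0
    rw [← h0]
    refine lintegral_mono fun t => indicator_le_indicator_of_subset ?_ (fun _ => zero_le) t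
    intro t _
    exact ENNReal.ofReal_lt_top
  · have := hfin y.toReal ENNReal.toReal_nonneg
    rwa [ENNReal.ofReal_toReal hy] at this

/-- The Hardy–Littlewood maximal theorem for finite exponents. The proof inserts the weak type
estimate into the layer cake formula. -/
lemma lintegral_maximalAverage_rpow_le {p : ℝ} (hp : 1 < p) {u : E → ℝ≥0∞} (hu : Measurable u) :
    ∃ C : ℝ≥0∞, C ≠ ⊤ ∧
      ∫⁻ x, maximalAverage μ (Ioi 0) u x ^ p ∂μ ≤ C * ∫⁻ x, u x ^ p ∂μ := by
  set M := maximalAverage μ (Ioi 0) u with hM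
  have hMm : Measurable M := measurable_maximalAverage _ u
  set K : ℝ≥0∞ := 2 * ENNReal.ofReal (5 ^ Module.finrank ℝ E) with hK
  have hp0 : 0 < p := by linarith
  have hp1 : 0 < p - 1 := by linarith
  refine ⟨ENNReal.ofReal p * (K * (ENNReal.ofReal (p - 1)⁻¹ * 2 ^ (p - 1))), ?_, ?_⟩
  · have : (2 : ℝ≥0∞) ^ (p - 1) ≠ ⊤ := ENNReal.rpow_ne_top_of_nonneg hp1.le (by simp)
    finiteness
  have hmeas : ∀ (v : E → ℝ≥0∞), Measurable v → ∀ q : ℝ,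
      Measurable (Function.uncurry fun (x : E) (t : ℝ) =>
        {t : ℝ | ENNReal.ofReal t < v x}.indicator (fun t => ENNReal.ofReal (t ^ q)) t) := by
    intro v hv q
    have : (Function.uncurry fun (x : E) (t : ℝ) =>
      {t : ℝ | ENNReal.ofReal t < v x}.indicator (fun t => ENNReal.ofReal (t ^ q)) t) =
      {z : E × ℝ | ENNReal.ofReal z.2 < v z.1}.indicator (fun z => ENNReal.ofReal (z.2 ^ q)) := by
      ext ⟨x, t⟩
      simp [Function.uncurry, indicator]
    rw [this]
    refine Measurable.indicator ?_ (measurableSet_lt (by fun_prop) (by fun_prop))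
    exact ENNReal.measurable_ofReal.comp (measurable_snd.pow_const q)
  calc ∫⁻ x, M x ^ p ∂μ
      = ENNReal.ofReal p * ∫⁻ x, ∫⁻ t in Ioi (0 : ℝ), {t : ℝ | ENNReal.ofReal t < M x}.indicator
          (fun t => ENNReal.ofReal (t ^ (p - 1))) t ∂volume ∂μ := by
        rw [← lintegral_const_mul' _ _ (by simp)]
        refine lintegral_congr fun x => ?_
        rw [lintegral_ofReal_rpow_indicator hp0, ← mul_assoc, ← ENNReal.ofReal_mul hp0.le,
          mul_inv_cancel₀ hp0.ne', ENNReal.ofReal_one, one_mul]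
    _ = ENNReal.ofReal p * ∫⁻ t in Ioi (0 : ℝ), ENNReal.ofReal (t ^ (p - 1)) *
          μ {x | ENNReal.ofReal t < M x} := by
        rw [lintegral_lintegral_swap (hmeas M hMm (p - 1)).aemeasurable]
        congr 1
        refine lintegral_congr fun t => ?_
        rw [← lintegral_indicator_const (measurableSet_lt measurable_const hMm)]
        rfl
    _ ≤ ENNReal.ofReal p * ∫⁻ t in Ioi (0 : ℝ), K * ∫⁻ x, u x *
          {t : ℝ | ENNReal.ofReal t < 2 * u x}.indicator
            (fun t => ENNReal.ofReal (t ^ (p - 1 - 1))) t ∂μ := by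
        gcongr ENNReal.ofReal p * ?_
        refine setLIntegral_mono' measurableSet_Ioi fun t ht => ?_
        have ht : 0 < t := ht
        have h1 : ENNReal.ofReal (t ^ (p - 1)) =
            ENNReal.ofReal (t ^ (p - 1 - 1)) * ENNReal.ofReal t := by
          rw [← ENNReal.ofReal_mul (by positivity), ← Real.rpow_add_one ht.ne', sub_add_cancel]
        have h2 : ∀ x, u x * {t : ℝ | ENNReal.ofReal t < 2 * u x}.indicator
            (fun t => ENNReal.ofReal (t ^ (p - 1 - 1))) t =
            ENNReal.ofReal (t ^ (p - 1 - 1)) *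
              {x | ENNReal.ofReal t < 2 * u x}.indicator u x := by
          intro x
          by_cases hx : ENNReal.ofReal t < 2 * u x
          · rw [indicator_of_mem (by exact hx), indicator_of_mem (by exact hx), mul_comm]
          · rw [indicator_of_notMem (by exact hx), indicator_of_notMem (by exact hx), mul_zero,
                mul_zero]
        simp_rw [h2]
        rw [lintegral_const_mul' _ _ (by simp),
          lintegral_indicator (measurableSet_lt measurable_const (hu.const_mul 2)), h1, mul_assoc,
          mul_left_comm K]
        gcongr ENNReal.ofReal (t ^ (p - 1 - 1)) * ?_
        exact mul_measure_lt_maximalAverage_le_setLIntegral u hu _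
    _ = ENNReal.ofReal p * (K * ∫⁻ x, u x * ∫⁻ t in Ioi (0 : ℝ),
          {t : ℝ | ENNReal.ofReal t < 2 * u x}.indicator
            (fun t => ENNReal.ofReal (t ^ (p - 1 - 1))) t ∂volume ∂μ) := by
        rw [lintegral_const_mul' _ _ (by finiteness), ← lintegral_lintegral_swap]
        · congr 3 with x
          rw [lintegral_const_mul]
          exact (hmeas _ (hu.const_mul 2) _).of_uncurry_left
        · exact ((hu.comp measurable_fst).mul (hmeas _ (hu.const_mul 2) _)).aemeasurable
    _ = ENNReal.ofReal p * (K * ∫⁻ x, (ENNReal.ofReal (p - 1)⁻¹ * 2 ^ (p - 1)) * u x ^ p ∂μ) := by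
        congr 3 with x
        rw [lintegral_ofReal_rpow_indicator hp1, ENNReal.mul_rpow_of_nonneg _ _ hp1.le]
        have : u x ^ p = u x * u x ^ (p - 1) := by
          conv_lhs => rw [← add_sub_cancel 1 p, ENNReal.rpow_add_of_nonneg _ _ zero_le_one hp1.le,
            ENNReal.rpow_one]
        rw [this]; ring
    _ = _ := by
        rw [lintegral_const_mul _ (hu.pow_const p)]; ring

/-- The Hardy–Littlewood maximal theorem for `1 < p ≤ ∞` and any set of positive radii. -/
lemma memLp_maximalAverage {S : Set ℝ} (hS : S ⊆ Ioi 0) {p : ℝ≥0∞} (hp : 1 < p) {u : E → ℝ≥0∞}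
    (hu : MemLp u p μ) : MemLp (maximalAverage μ S u) p μ := by
  have hmain : MemLp (maximalAverage μ (Ioi 0) u) p μ := by
    refine ⟨(measurable_maximalAverage _ u).aestronglyMeasurable, ?_⟩
    rcases eq_or_ne p ⊤ with rfl | hpt
    · rw [eLpNorm_exponent_top]
      refine lt_of_le_of_lt (eLpNormEssSup_le_of_ae_enorm_bound ?_) hu.2
      refine Filter.Eventually.of_forall fun x => iSup₂_le fun r _ => ?_
      rw [eLpNorm_exponent_top]
      exact ballAverage_le_of_ae_le ae_le_eLpNormEssSup r x
    · have hp0 : p ≠ 0 := (zero_lt_one.trans hp).ne'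
      have hp1 : 1 < p.toReal := by
        rw [← ENNReal.toReal_one]
        exact (ENNReal.toReal_lt_toReal (by simp) hpt).2 hp
      obtain ⟨v, hv, huv⟩ := hu.1.aemeasurable
      have hfin := lintegral_rpow_enorm_lt_top_of_eLpNorm_lt_top hp0 hpt (hu.ae_eq huv).2
      obtain ⟨C, hC, hle⟩ := lintegral_maximalAverage_rpow_le (μ := μ) hp1 hv
      rw [eLpNorm_lt_top_iff_lintegral_rpow_enorm_lt_top hp0 hpt]
      refine lt_of_le_of_lt ?_ (ENNReal.mul_lt_top hC.lt_top hfin)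
      refine le_trans (lintegral_mono fun x => ?_) hle
      exact ENNReal.rpow_le_rpow (iSup₂_mono fun r _ =>
        ballAverage_mono_ae (huv.mono fun z hz => hz.le) r x) (by positivity)
  exact hmain.of_le_enorm (measurable_maximalAverage _ u).aestronglyMeasurable
    (Filter.Eventually.of_forall fun x => maximalAverage_mono_set hS u x)

end MaximalAverage

/-! ### Mean difference quotients -/

lemma maximalMeanQuotient_eq {n : ℕ} (f : EuclideanSpace ℝ (Fin n) → ℝ)
    (x : EuclideanSpace ℝ (Fin n)) :
    maximalMeanQuotient f x =
      maximalAverage volume (Ioi 0) (fun z => ‖f z - f x‖ₑ / ‖z - x‖ₑ) x :=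
  rfl

/-- Two values of `f` are compared through the values on the ball with diameter from `x` to `y`,
which is contained in both `B(x, |x - y|)` and `B(y, |x - y|)`. -/
lemma enorm_sub_le_meanQuotient {n : ℕ} {f : EuclideanSpace ℝ (Fin n) → ℝ}
    (hf : AEMeasurable f volume) (x y : EuclideanSpace ℝ (Fin n)) :
    ‖f x - f y‖ₑ ≤
      2 ^ n * ‖x - y‖ₑ * (meanQuotient f ‖x - y‖ x + meanQuotient f ‖x - y‖ y) := by
  rcases eq_or_ne x y with rfl | hxy
  · simp
  set r := ‖x - y‖ with hr
  have hr0 : 0 < r := norm_pos_iff.2 (sub_ne_zero.2 hxy)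
  set m := midpoint ℝ x y
  set B := Metric.ball m (r / 2)
  set b := volume B with hb
  have hb0 : b ≠ 0 := (Metric.measure_ball_pos volume m (by positivity)).ne'
  have hbt : b ≠ ⊤ := measure_ball_lt_top.ne
  have hmx : dist m x = r / 2 := by rw [dist_midpoint_left, dist_eq_norm, Real.norm_ofNat]; ring
  have hmy : dist m y = r / 2 := by rw [dist_midpoint_right, dist_eq_norm, Real.norm_ofNat]; ring
  have hsub : ∀ w, dist m w = r / 2 → B ⊆ Metric.ball w r := fun w hw =>
    Metric.ball_subset_ball' (by rw [hw]; linarith)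
  have hvol : ∀ w : EuclideanSpace ℝ (Fin n), volume (Metric.ball w r) = 2 ^ n * b := by
    intro w
    rw [hb, Measure.addHaar_ball_of_pos volume w hr0,
      Measure.addHaar_ball_of_pos volume m (by positivity), finrank_euclideanSpace_fin, ← mul_assoc]
    congr 1
    rw [← ENNReal.ofReal_ofNat, ← ENNReal.ofReal_pow (by norm_num),
      ← ENNReal.ofReal_mul (by positivity), ← mul_pow]
    congr 2
    ring
  have hq : ∀ w, ∀ z ∈ Metric.ball w r, ‖f z - f w‖ₑ ≤ ‖x - y‖ₑ * (‖f z - f w‖ₑ / ‖z - w‖ₑ) := by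
    intro w z hz
    -- at the centre of the ball the quotient is `0 / 0 = 0`, and so is the left-hand side
    rcases eq_or_ne z w with rfl | hzw
    · simp
    have h0 : ‖z - w‖ₑ ≠ 0 := by simpa [sub_eq_zero] using hzw
    have hle : ‖z - w‖ₑ ≤ ‖x - y‖ₑ := by
      rw [enorm_le_iff_norm_le, ← dist_eq_norm]
      exact (Metric.mem_ball.1 hz).le
    calc ‖f z - f w‖ₑ = ‖z - w‖ₑ * (‖f z - f w‖ₑ / ‖z - w‖ₑ) :=
          (ENNReal.mul_div_cancel h0 enorm_ne_top).symm
      _ ≤ _ := by gcongr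
  have hmain : ‖f x - f y‖ₑ * b ≤ ‖x - y‖ₑ *
      ((∫⁻ z in Metric.ball x r, ‖f z - f x‖ₑ / ‖z - x‖ₑ) +
      ∫⁻ z in Metric.ball y r, ‖f z - f y‖ₑ / ‖z - y‖ₑ) := by
    calc ‖f x - f y‖ₑ * b = ∫⁻ _ in B, ‖f x - f y‖ₑ := by
          rw [lintegral_const, Measure.restrict_apply_univ]
      _ ≤ ∫⁻ z in B, (‖x - y‖ₑ * (‖f z - f x‖ₑ / ‖z - x‖ₑ) +
            ‖x - y‖ₑ * (‖f z - f y‖ₑ / ‖z - y‖ₑ)) := by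
          refine setLIntegral_mono' measurableSet_ball fun z hz => ?_
          refine le_trans ?_ (add_le_add (hq x z (hsub x hmx hz)) (hq y z (hsub y hmy hz)))
          have : f x - f y = (f z - f y) - (f z - f x) := by ring
          rw [this, add_comm]
          exact enorm_sub_le
      _ = ‖x - y‖ₑ * ((∫⁻ z in B, ‖f z - f x‖ₑ / ‖z - x‖ₑ) +
            ∫⁻ z in B, ‖f z - f y‖ₑ / ‖z - y‖ₑ) := by
          rw [lintegral_add_left', lintegral_const_mul' _ _ enorm_ne_top,
            lintegral_const_mul' _ _ enorm_ne_top, mul_add]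
          have := (hf.mono_measure (Measure.restrict_le_self (s := B)))
          fun_prop
      _ ≤ _ := by
          gcongr
          · exact hsub x hmx
          · exact hsub y hmy
  rw [meanQuotient, meanQuotient, hvol, hvol, ← mul_add]
  set I := (∫⁻ z in Metric.ball x r, ‖f z - f x‖ₑ / ‖z - x‖ₑ) +
      ∫⁻ z in Metric.ball y r, ‖f z - f y‖ₑ / ‖z - y‖ₑ
  have h2 : (2 : ℝ≥0∞) ^ n ≠ 0 := by simp
  have h2t : (2 : ℝ≥0∞) ^ n ≠ ⊤ := by simp
  calc ‖f x - f y‖ₑ ≤ ‖x - y‖ₑ * I / b :=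
        (ENNReal.le_div_iff_mul_le (by simp [hb0]) (by simp [hbt])).2 hmain
    _ = (2 ^ n * (2 ^ n)⁻¹) * (‖x - y‖ₑ * I / b) := by rw [ENNReal.mul_inv_cancel h2 h2t, one_mul]
    _ = _ := by
      rw [ENNReal.mul_inv (Or.inl h2) (Or.inl h2t), div_eq_mul_inv]
      ring

/-- Rescaling the variable by a homothety centred at `x`. -/
lemma ballAverage_comp_homothety {E : Type*} [NormedAddCommGroup E] [NormedSpace ℝ E]
    [FiniteDimensional ℝ E] [MeasurableSpace E] [BorelSpace E] (μ : Measure E) [μ.IsAddHaarMeasure]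
    {u : E → ℝ≥0∞} (hu : Measurable u) {t : ℝ} (ht : 0 < t) (r : ℝ) (x : E) :
    ballAverage μ (fun z => u (x + t • (z - x))) r x = ballAverage μ u (t * r) x := by
  have htrans : ∀ (v : E → ℝ≥0∞) (s : ℝ), ∫⁻ z in Metric.ball x s, v z ∂μ =
      ∫⁻ w in Metric.ball 0 s, v (x + w) ∂μ := by
    intro v s
    rw [← lintegral_indicator measurableSet_ball, ← lintegral_indicator measurableSet_ball,
      ← lintegral_add_left_eq_self _ x]
    refine lintegral_congr fun w => ?_
    simp only [indicator, Metric.mem_ball, dist_eq_norm, add_sub_cancel_left, sub_zero]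
  have hpre : (fun w : E => t • w) ⁻¹' Metric.ball 0 (t * r) = Metric.ball 0 r := by
    ext w
    simp [norm_smul, abs_of_pos ht, ht]
  have hscale : ∫⁻ w in Metric.ball 0 r, u (x + t • w) ∂μ =
      ENNReal.ofReal |(t ^ Module.finrank ℝ E)⁻¹| *
        ∫⁻ w in Metric.ball 0 (t * r), u (x + w) ∂μ := by
    rw [← hpre, ← setLIntegral_map (f := fun w => u (x + w)) measurableSet_ball (by fun_prop)
      (by fun_prop),
      Measure.map_addHaar_smul μ ht.ne', Measure.restrict_smul, lintegral_smul_measure, smul_eq_mul]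
  rw [ballAverage, ballAverage, htrans, htrans u]
  simp only [add_sub_cancel_left]
  have hpow : ENNReal.ofReal |(t ^ Module.finrank ℝ E)⁻¹| =
      (ENNReal.ofReal (t ^ Module.finrank ℝ E))⁻¹ := by
    rw [abs_of_pos (by positivity), ENNReal.ofReal_inv_of_pos (by positivity)]
  rw [hscale, Measure.addHaar_ball_mul_of_pos μ x ht, Measure.addHaar_ball_center,
    ENNReal.mul_inv (Or.inl (by positivity)) (Or.inl (by simp)), hpow]
  ring

/-- The mean difference quotient of a `C¹` function is dominated by the averages of its gradient
over concentric balls, by the fundamental theorem of calculus on the segments issuing from `x`. -/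
lemma meanQuotient_le_maximalAverage_fderiv {n : ℕ} {φ : EuclideanSpace ℝ (Fin n) → ℝ}
    (hφ : ContDiff ℝ 1 φ) {r : ℝ} (hr : 0 < r) (x : EuclideanSpace ℝ (Fin n)) :
    meanQuotient φ r x ≤ maximalAverage volume (Ioc 0 r) (fun w => ‖fderiv ℝ φ w‖ₑ) x := by
  set u : EuclideanSpace ℝ (Fin n) → ℝ≥0∞ := fun w => ‖fderiv ℝ φ w‖ₑ with hu
  have hcont : Continuous (fderiv ℝ φ) := hφ.continuous_fderiv (by norm_num)
  have hum : Measurable u := hcont.enorm.measurable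
  have hpt : ∀ z, ‖φ z - φ x‖ₑ / ‖z - x‖ₑ ≤ ∫⁻ t in Ioc (0 : ℝ) 1, u (x + t • (z - x)) := by
    intro z
    refine ENNReal.div_le_of_le_mul ?_
    have hd : ∀ t : ℝ, HasDerivAt (fun t : ℝ => φ (x + t • (z - x)))
        (fderiv ℝ φ (x + t • (z - x)) (z - x)) t := by
      intro t
      have h1 : HasDerivAt (fun t : ℝ => x + t • (z - x)) (z - x) t := by
        simpa using ((hasDerivAt_id t).smul_const (z - x)).const_add x
      exact ((hφ.differentiable (by norm_num)) _).hasFDerivAt.comp_hasDerivAt t h1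
    have hFTC := intervalIntegral.integral_eq_sub_of_hasDerivAt (a := 0) (b := 1)
      (fun t _ => hd t) (Continuous.intervalIntegrable (by fun_prop) _ _)
    have hz : φ z - φ x = ∫ t in Ioc (0 : ℝ) 1, fderiv ℝ φ (x + t • (z - x)) (z - x) := by
      rw [← intervalIntegral.integral_of_le zero_le_one, hFTC]; simp
    rw [hz, ← lintegral_mul_const' _ _ enorm_ne_top]
    refine (enorm_integral_le_lintegral_enorm _).trans (lintegral_mono fun t => ?_)
    exact ContinuousLinearMap.le_opENorm _ _
  calc meanQuotient φ r x
      ≤ (volume (Metric.ball x r))⁻¹ *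
          ∫⁻ z in Metric.ball x r, ∫⁻ t in Ioc (0 : ℝ) 1, u (x + t • (z - x)) := by
        rw [meanQuotient]
        gcongr with z
        exact hpt z
    _ = ∫⁻ t in Ioc (0 : ℝ) 1, ballAverage volume (fun z => u (x + t • (z - x))) r x := by
        rw [lintegral_lintegral_swap, ← lintegral_const_mul']
        · rfl
        · exact ENNReal.inv_ne_top.2 (Metric.measure_ball_pos volume x hr).ne'
        · have : Continuous (fun q : EuclideanSpace ℝ (Fin n) × ℝ => x + q.2 • (q.1 - x)) := by
            fun_prop
          exact (hum.comp this.measurable).aemeasurable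
    _ ≤ ∫⁻ _ in Ioc (0 : ℝ) 1, maximalAverage volume (Ioc 0 r) u x := by
        refine setLIntegral_mono' measurableSet_Ioc fun t ht => ?_
        rw [ballAverage_comp_homothety volume hum ht.1]
        have hmem : t * r ∈ Ioc 0 r := ⟨mul_pos ht.1 hr, mul_le_of_le_one_left hr.le ht.2⟩
        exact ballAverage_le_maximalAverage hmem u x
    _ = _ := by simp

lemma aemeasurable_maximalMeanQuotient {n : ℕ} {f : EuclideanSpace ℝ (Fin n) → ℝ}
    (hf : AEMeasurable f volume) : AEMeasurable (maximalMeanQuotient f) volume := by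
  obtain ⟨g, hg, hfg⟩ := hf
  refine ⟨fun x => ⨆ q : ℚ, meanQuotient g q x, ?_, ?_⟩
  · refine Measurable.iSup fun q => ?_
    have h1 : ∀ x, meanQuotient g q x =
        (volume (Metric.ball (0 : EuclideanSpace ℝ (Fin n)) (q : ℝ)))⁻¹ *
        ∫⁻ z, {w : EuclideanSpace ℝ (Fin n) × EuclideanSpace ℝ (Fin n) | dist w.2 w.1 < q}.indicator
          (fun w => ‖g w.2 - g w.1‖ₑ / ‖w.2 - w.1‖ₑ) (x, z) := by
      intro x
      rw [meanQuotient, Measure.addHaar_ball_center, ← lintegral_indicator measurableSet_ball]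
      rfl
    rw [show meanQuotient g q = _ from funext h1]
    refine Measurable.const_mul (Measurable.lintegral_prod_right' (Measurable.indicator ?_ ?_)) _
    · fun_prop
    · exact measurableSet_lt (by fun_prop) measurable_const
  · filter_upwards [hfg] with x hx
    rw [maximalMeanQuotient_eq, maximalAverage_eq_iSup_rat]
    refine iSup_congr fun q => ?_
    rw [meanQuotient, ballAverage]
    congr 1
    refine lintegral_congr_ae (ae_restrict_of_ae ?_)
    filter_upwards [hfg] with z hz
    rw [hx, hz]

/-! ### Mollification -/

section Mollification

open Filter ContinuousLinearMap
open scoped Topology Convolution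

/-- A sequence of smooth bump functions centred at the origin, with support shrinking to it. -/
noncomputable def mollifier (E : Type*) [NormedAddCommGroup E] (k : ℕ) : ContDiffBump (0 : E) where
  rIn := 1 / (2 * ((k : ℝ) + 1))
  rOut := 1 / ((k : ℝ) + 1)
  rIn_pos := by positivity
  rIn_lt_rOut := by
    rw [one_div_lt_one_div (by positivity) (by positivity)]
    have : (0 : ℝ) < (k : ℝ) + 1 := by positivity
    linarith

variable {E : Type*} [NormedAddCommGroup E] [InnerProductSpace ℝ E] [FiniteDimensional ℝ E]
  [MeasurableSpace E] (μ : Measure E)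

/-- The convolution of `f` with the `k`-th normalized mollifier. -/
noncomputable def mollify (k : ℕ) (f : E → ℝ) : E → ℝ :=
  (mollifier E k).normed μ ⋆[lsmul ℝ ℝ, μ] f

/-- The convolution of an extended nonnegative function with the `k`-th normalized mollifier. -/
noncomputable def lmollify (k : ℕ) (u : E → ℝ≥0∞) (x : E) : ℝ≥0∞ :=
  ∫⁻ t, ENNReal.ofReal ((mollifier E k).normed μ t) * u (x - t) ∂μ

lemma mollify_apply (k : ℕ) (f : E → ℝ) (x : E) :
    mollify μ k f x = ∫ t, (mollifier E k).normed μ t * f (x - t) ∂μ :=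
  rfl

lemma enorm_mollify_le (k : ℕ) (f : E → ℝ) (x : E) :
    ‖mollify μ k f x‖ₑ ≤ lmollify μ k (fun z => ‖f z‖ₑ) x := by
  rw [mollify_apply]
  refine (enorm_integral_le_lintegral_enorm _).trans (lintegral_mono fun t => ?_)
  rw [enorm_mul, Real.enorm_of_nonneg (ContDiffBump.nonneg_normed _ _)]

variable [BorelSpace E] [μ.IsAddHaarMeasure]

lemma ae_tendsto_mollify {f : E → ℝ} (hf : LocallyIntegrable f μ) :
    ∀ᵐ x ∂μ, Tendsto (fun k => mollify μ k f x) atTop (𝓝 (f x)) := by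
  refine ContDiffBump.ae_convolution_tendsto_right_of_locallyIntegrable (K := 2) ?_ ?_ hf
  · exact tendsto_one_div_add_atTop_nhds_zero_nat
  · refine Eventually.of_forall fun k => le_of_eq ?_
    simp only [mollifier]
    field_simp

lemma lmollify_congr_ae {u v : E → ℝ≥0∞} (h : u =ᵐ[μ] v) (k : ℕ) (x : E) :
    lmollify μ k u x = lmollify μ k v x := by
  refine lintegral_congr_ae ?_
  have hqmp := (Measure.measurePreserving_sub_left μ x).quasiMeasurePreserving
  filter_upwards [hqmp.ae_eq_comp h] with t ht
  simp only [Function.comp_apply] at ht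
  rw [ht]

lemma lmollify_mono_ae {u v : E → ℝ≥0∞} (h : ∀ᵐ z ∂μ, u z ≤ v z) (k : ℕ) (x : E) :
    lmollify μ k u x ≤ lmollify μ k v x := by
  refine lintegral_mono_ae ?_
  filter_upwards [(Measure.measurePreserving_sub_left μ x).quasiMeasurePreserving.ae h] with t ht
  gcongr

lemma lmollify_finset_sum {ι : Type*} (s : Finset ι) {u : ι → E → ℝ≥0∞}
    (hu : ∀ i ∈ s, AEMeasurable (u i) μ) (k : ℕ) (x : E) :
    lmollify μ k (fun z => ∑ i ∈ s, u i z) x = ∑ i ∈ s, lmollify μ k (u i) x := by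
  simp only [lmollify, Finset.mul_sum]
  refine lintegral_finsetSum' s fun i hi => ?_
  have h1 : AEMeasurable (fun t => u i (x - t)) μ :=
    (hu i hi).comp_quasiMeasurePreserving
      (Measure.measurePreserving_sub_left μ x).quasiMeasurePreserving
  have h2 : Measurable ((mollifier E k).normed μ) :=
    (ContDiffBump.continuous_normed _).measurable
  exact h2.ennreal_ofReal.aemeasurable.mul h1

lemma tendsto_lmollify {u : E → ℝ≥0∞} (hu : LocallyIntegrable (fun z => (u z).toReal) μ)
    (hfin : ∀ᵐ z ∂μ, u z ≠ ⊤) :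
    ∀ᵐ x ∂μ, Tendsto (fun k => lmollify μ k u x) atTop (𝓝 (u x)) := by
  filter_upwards [ae_tendsto_mollify μ hu, hfin] with x hx hxt
  have h1 : ∀ k, lmollify μ k u x = ENNReal.ofReal (mollify μ k (fun z => (u z).toReal) x) := by
    intro k
    have hae : u =ᵐ[μ] fun z => ENNReal.ofReal (u z).toReal := by
      filter_upwards [hfin] with z hz using (ENNReal.ofReal_toReal hz).symm
    rw [lmollify_congr_ae μ hae, mollify_apply, ofReal_integral_eq_lintegral_ofReal]
    · refine lintegral_congr fun t => ?_
      rw [ENNReal.ofReal_mul (ContDiffBump.nonneg_normed _ _)]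
    · exact ((mollifier E k).hasCompactSupport_normed.convolutionExists_left (lsmul ℝ ℝ)
        (mollifier E k).continuous_normed hu) x
    · exact Eventually.of_forall fun t =>
        mul_nonneg (ContDiffBump.nonneg_normed _ _) ENNReal.toReal_nonneg
  simp_rw [h1]
  have := ENNReal.tendsto_ofReal hx
  rwa [ENNReal.ofReal_toReal hxt] at this

/-- Ball averages commute with convolutions, and averaging does not increase suprema, so
maximal functions are subordinate to convolution. -/
lemma maximalAverage_lmollify_le (S : Set ℝ) {u : E → ℝ≥0∞} (hu : Measurable u) (k : ℕ) (x : E) :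
    maximalAverage μ S (lmollify μ k u) x ≤ lmollify μ k (maximalAverage μ S u) x := by
  have hρ : Measurable ((mollifier E k).normed μ) :=
    (ContDiffBump.continuous_normed _).measurable
  refine iSup₂_le fun r hr => ?_
  have htrans : ∀ t, ∫⁻ z in Metric.ball x r, u (z - t) ∂μ =
      ∫⁻ z in Metric.ball (x - t) r, u z ∂μ := by
    intro t
    rw [← lintegral_indicator measurableSet_ball, ← lintegral_indicator measurableSet_ball,
      ← lintegral_sub_right_eq_self (fun z => (Metric.ball (x - t) r).indicator u z) t]
    refine lintegral_congr fun w => ?_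
    simp only [indicator, Metric.mem_ball, dist_sub_right]
  rcases le_or_gt r 0 with hr0 | hr0
  · simp [ballAverage, Metric.ball_eq_empty.2 hr0]
  calc ballAverage μ (lmollify μ k u) r x
      = (μ (Metric.ball x r))⁻¹ * ∫⁻ t, ENNReal.ofReal ((mollifier E k).normed μ t) *
          ∫⁻ z in Metric.ball (x - t) r, u z ∂μ ∂μ := by
        simp only [ballAverage, lmollify]
        rw [lintegral_lintegral_swap]
        · congr 2 with t
          rw [lintegral_const_mul' _ _ ENNReal.ofReal_ne_top, htrans]
        · exact Measurable.aemeasurable (by fun_prop)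
    _ = ∫⁻ t, ENNReal.ofReal ((mollifier E k).normed μ t) * ballAverage μ u r (x - t) ∂μ := by
        rw [← lintegral_const_mul' _ _
          (ENNReal.inv_ne_top.2 (Metric.measure_ball_pos μ x hr0).ne')]
        refine lintegral_congr fun t => ?_
        rw [ballAverage, Measure.addHaar_ball_center, Measure.addHaar_ball_center μ (x - t)]
        ring
    _ ≤ _ := by
        refine lintegral_mono fun t => ?_
        gcongr
        exact ballAverage_le_maximalAverage hr u _

lemma contDiff_mollify {f : E → ℝ} (hf : LocallyIntegrable f μ) (k : ℕ) {m : ℕ∞} :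
    ContDiff ℝ m (mollify μ k f) :=
  (mollifier E k).hasCompactSupport_normed.contDiff_convolution_left _
    (mollifier E k).contDiff_normed hf

end Mollification

/-! ### The pointwise estimate for functions with weak derivatives -/

section WeakDerivative

open Filter ContinuousLinearMap
open scoped Topology Convolution

variable {n : ℕ}

/-- Mollification turns weak partial derivatives into classical ones. -/
lemma fderiv_mollify_single {i : Fin n} {f h : EuclideanSpace ℝ (Fin n) → ℝ}
    (hfh : HasWeakPartial i f h) (k : ℕ) (x : EuclideanSpace ℝ (Fin n)) :
    fderiv ℝ (mollify volume k f) x (EuclideanSpace.single i 1) = mollify volume k h x := by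
  set ρ := (mollifier (EuclideanSpace ℝ (Fin n)) k).normed volume with hρ
  have hρs : HasCompactSupport ρ := (mollifier _ k).hasCompactSupport_normed
  have hρd : ContDiff ℝ ∞ ρ := (mollifier _ k).contDiff_normed
  have hflip : ∀ g : EuclideanSpace ℝ (Fin n) → ℝ,
      mollify volume k g = g ⋆[lsmul ℝ ℝ, volume] ρ := by
    intro g
    ext z
    rw [mollify, convolution_eq_swap, convolution_def]
    simp [mul_comm, hρ]
  have hd : HasFDerivAt (mollify volume k f)
      ((f ⋆[(lsmul ℝ ℝ).precompR (EuclideanSpace ℝ (Fin n)), volume] fderiv ℝ ρ) x) x := by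
    rw [hflip]
    exact hρs.hasFDerivAt_convolution_right _ hfh.1 (hρd.of_le (by norm_num)) x
  rw [hd.fderiv, convolution_precompR_apply _ hfh.1 (hρs.fderiv ℝ)
    (hρd.continuous_fderiv (by norm_num)), hflip]
  have hφd : ContDiff ℝ ∞ fun t => ρ (x - t) := hρd.comp (contDiff_const.sub contDiff_id)
  have hφs : HasCompactSupport fun t => ρ (x - t) :=
    hρs.comp_homeomorph (Homeomorph.subLeft x)
  have hfd : ∀ t, fderiv ℝ (fun t => ρ (x - t)) t (EuclideanSpace.single i 1) =
      -fderiv ℝ ρ (x - t) (EuclideanSpace.single i 1) := by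
    intro t
    have h1 := ((hρd.differentiable (by norm_num)) (x - t)).hasFDerivAt.comp t
      ((hasFDerivAt_id t).const_sub x)
    have h2 := h1.fderiv
    simp only [Function.comp_def] at h2
    rw [h2]
    simp
  have := hfh.2.2 _ hφd hφs
  simp only [hfd, mul_neg, integral_neg, neg_inj] at this
  simpa [convolution_def] using this

lemma enorm_le_sum_enorm_single (L : EuclideanSpace ℝ (Fin n) →L[ℝ] ℝ) :
    ‖L‖ₑ ≤ ∑ i, ‖L (EuclideanSpace.single i 1)‖ₑ := by
  have h : ‖L‖ ≤ ∑ i, ‖L (EuclideanSpace.single i 1)‖ := by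
    refine L.opNorm_le_bound (by positivity) fun v => ?_
    have hv : v = ∑ i, v i • EuclideanSpace.single i (1 : ℝ) := by
      ext j
      simp [Finset.sum_apply, Pi.single_apply]
    conv_lhs => rw [hv, map_sum]
    rw [Finset.sum_mul]
    refine (norm_sum_le _ _).trans (Finset.sum_le_sum fun i _ => ?_)
    rw [map_smul, norm_smul, mul_comm]
    gcongr
    exact PiLp.norm_apply_le v i
  rw [← ofReal_norm]
  refine (ENNReal.ofReal_le_ofReal h).trans_eq ?_
  rw [ENNReal.ofReal_sum_of_nonneg fun _ _ => norm_nonneg _]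
  simp only [ofReal_norm]

/-- The pointwise estimate behind the inclusion of Sobolev spaces in Hajłasz spaces. For smooth
functions it combines the estimates of mean quotients from above and from below; the general case
follows by mollification, since both sides converge almost everywhere. -/
lemma exists_null_enorm_sub_le_maximalAverage {f : EuclideanSpace ℝ (Fin n) → ℝ}
    {h : Fin n → EuclideanSpace ℝ (Fin n) → ℝ} (hfh : ∀ i, HasWeakPartial i f (h i))
    (R : ℝ)
    (hM : ∀ᵐ z, maximalAverage volume (Ioc 0 R) (fun z => ∑ i, ‖h i z‖ₑ) z ≠ ⊤)
    (hMi : LocallyIntegrable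
      (fun z => (maximalAverage volume (Ioc 0 R) (fun z => ∑ i, ‖h i z‖ₑ) z).toReal) volume)
    (hf : LocallyIntegrable f volume) :
    ∃ N : Set (EuclideanSpace ℝ (Fin n)), volume N = 0 ∧ ∀ x ∉ N, ∀ y ∉ N, ‖x - y‖ ≤ R →
      ‖f x - f y‖ₑ ≤ 2 ^ n * ‖x - y‖ₑ *
        (maximalAverage volume (Ioc 0 R) (fun z => ∑ i, ‖h i z‖ₑ) x +
          maximalAverage volume (Ioc 0 R) (fun z => ∑ i, ‖h i z‖ₑ) y) := by
  set u : EuclideanSpace ℝ (Fin n) → ℝ≥0∞ := fun z => ∑ i, ‖h i z‖ₑ with hu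
  set M := maximalAverage volume (Ioc 0 R) u with hMdef
  have hum : AEMeasurable u volume :=
    Finset.aemeasurable_fun_sum _ fun i _ => (hfh i).2.1.aestronglyMeasurable.enorm
  obtain ⟨v, hv, huv⟩ := hum
  have hgood := (ae_tendsto_mollify volume hf).and ((tendsto_lmollify volume hMi hM))
  refine ⟨_, hgood, fun x hx y hy hxy => ?_⟩
  rw [mem_compl_iff, not_not] at hx hy
  obtain ⟨hx1, hx2⟩ := hx
  obtain ⟨hy1, hy2⟩ := hy
  rcases eq_or_ne x y with rfl | hne
  · simp
  have hr0 : 0 < ‖x - y‖ := norm_pos_iff.2 (sub_ne_zero.2 hne)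
  have hmq : ∀ k w, meanQuotient (mollify volume k f) ‖x - y‖ w ≤ lmollify volume k M w := by
    intro k w
    have hgrad : ∀ z, ‖fderiv ℝ (mollify volume k f) z‖ₑ ≤ lmollify volume k v z := by
      intro z
      refine (enorm_le_sum_enorm_single _).trans ?_
      rw [← lmollify_congr_ae volume huv, hu, lmollify_finset_sum]
      · refine Finset.sum_le_sum fun i _ => ?_
        rw [fderiv_mollify_single (hfh i)]
        exact enorm_mollify_le volume k _ z
      · exact fun i _ => (hfh i).2.1.aestronglyMeasurable.enorm
    calc meanQuotient (mollify volume k f) ‖x - y‖ w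
        ≤ maximalAverage volume (Ioc 0 ‖x - y‖)
            (fun z => ‖fderiv ℝ (mollify volume k f) z‖ₑ) w :=
          meanQuotient_le_maximalAverage_fderiv (contDiff_mollify volume hf k) hr0 w
      _ ≤ maximalAverage volume (Ioc 0 R) (lmollify volume k v) w :=
          (maximalAverage_mono_set (Ioc_subset_Ioc_right hxy) _ w).trans
            (maximalAverage_mono hgrad w)
      _ ≤ lmollify volume k (maximalAverage volume (Ioc 0 R) v) w :=
          maximalAverage_lmollify_le volume _ hv k w
      _ ≤ lmollify volume k M w := by
          refine lmollify_mono_ae volume (Eventually.of_forall fun z => ?_) k w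
          exact iSup₂_mono fun r _ => ballAverage_mono_ae (huv.mono fun z hz => hz.ge) r z
  have hk : ∀ k, ‖mollify volume k f x - mollify volume k f y‖ₑ ≤
      2 ^ n * ‖x - y‖ₑ * (lmollify volume k M x + lmollify volume k M y) := by
    intro k
    refine (enorm_sub_le_meanQuotient
      (contDiff_mollify volume hf k (m := 1)).continuous.aemeasurable x y).trans ?_
    gcongr
    · exact hmq k x
    · exact hmq k y
  refine le_of_tendsto_of_tendsto' ((hx1.sub hy1).enorm) ?_ hk
  exact ENNReal.Tendsto.const_mul (hx2.add hy2) (Or.inr (by finiteness))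

end WeakDerivative

/-! ### Functionals on test functions dominated by a weighted `L¹` norm -/

section Representation

open Filter ContinuousLinearMap
open scoped Topology

variable {E : Type*} [NormedAddCommGroup E] [InnerProductSpace ℝ E]

variable (E) in
/-- The space of smooth, compactly supported real functions. -/
def testFunctions : Submodule ℝ (E → ℝ) where
  carrier := {φ | ContDiff ℝ ∞ φ ∧ HasCompactSupport φ}
  add_mem' h₁ h₂ := ⟨h₁.1.add h₂.1, h₁.2.add h₂.2⟩
  zero_mem' := ⟨contDiff_const, HasCompactSupport.zero⟩
  smul_mem' _ _ h := ⟨contDiff_const.smul h.1, h.2.smul_left⟩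

variable [FiniteDimensional ℝ E] [MeasurableSpace E] [BorelSpace E] {μ : Measure E}

/-- A locally integrable function becomes integrable after multiplication by a weight that is
bounded below on bounded sets; the weight is a rapidly decreasing sum of indicators of balls. -/
lemma exists_weight_integrable_mul {G : E → ℝ} (hG : LocallyIntegrable G μ) :
    ∃ w : E → ℝ, Measurable w ∧ (∀ R : ℝ, ∃ c > 0, ∀ x ∈ Metric.ball (0 : E) R, c ≤ w x) ∧
      Integrable (fun x => G x * w x) μ := by
  set m : ℕ → ℝ≥0∞ := fun j => ∫⁻ x in Metric.ball (0 : E) (j + 1), ‖G x‖ₑ ∂μ with hm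
  have hmt : ∀ j, m j ≠ ⊤ := fun j =>
    ((hG.integrableOn_isCompact (isCompact_closedBall 0 ((j : ℝ) + 1))).mono_set
      Metric.ball_subset_closedBall).2.ne
  obtain ⟨δ, hδ, hsum⟩ := ENNReal.exists_pos_tsum_mul_lt_of_countable one_ne_zero
    (fun j => 1 + m j) (fun j => by simp [hmt j])
  -- summability of `δ` itself keeps the weight finite, that of `m j * δ j` keeps `G w` integrable
  set U : E → ℝ≥0∞ := fun x => ∑' j : ℕ, (Metric.ball (0 : E) ((j : ℝ) + 1)).indicator
    (fun _ => (δ j : ℝ≥0∞)) x with hU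
  have hUm : Measurable U :=
    Measurable.tsum fun j => measurable_const.indicator measurableSet_ball
  have hUt : ∀ x, U x ≠ ⊤ := by
    intro x
    refine (lt_of_le_of_lt (ENNReal.tsum_le_tsum fun j => ?_) hsum).ne_top
    refine (indicator_le_self _ _ _).trans ?_
    exact le_mul_of_one_le_left' le_self_add
  refine ⟨fun x => (U x).toReal, hUm.ennreal_toReal, fun R => ?_, ?_⟩
  · obtain ⟨j, hj⟩ := exists_nat_ge R
    refine ⟨δ j, hδ j, fun x hx => ?_⟩
    have hxj : x ∈ Metric.ball (0 : E) ((j : ℝ) + 1) :=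
      Metric.ball_subset_ball (by linarith) hx
    have h1 : (δ j : ℝ≥0∞) ≤ U x := by
      refine le_trans ?_ (ENNReal.le_tsum j)
      rw [indicator_of_mem hxj]
    simpa using ENNReal.toReal_mono (hUt x) h1
  · refine ⟨hG.aestronglyMeasurable.mul hUm.ennreal_toReal.aestronglyMeasurable, ?_⟩
    calc ∫⁻ x, ‖G x * (U x).toReal‖ₑ ∂μ = ∫⁻ x, ∑' j : ℕ, ‖G x‖ₑ *
          (Metric.ball (0 : E) ((j : ℝ) + 1)).indicator (fun _ => (δ j : ℝ≥0∞)) x ∂μ := by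
          refine lintegral_congr fun x => ?_
          rw [ENNReal.tsum_mul_left, enorm_mul, Real.enorm_of_nonneg ENNReal.toReal_nonneg,
            ENNReal.ofReal_toReal (hUt x)]
      _ = ∑' j : ℕ, m j * δ j := by
          rw [lintegral_tsum]
          · refine tsum_congr fun j => ?_
            rw [hm, ← lintegral_mul_const' _ _ ENNReal.coe_ne_top,
              ← lintegral_indicator measurableSet_ball]
            refine lintegral_congr fun x => ?_
            by_cases hx : x ∈ Metric.ball (0 : E) ((j : ℝ) + 1)
            · rw [indicator_of_mem hx, indicator_of_mem hx]
            · rw [indicator_of_notMem hx, indicator_of_notMem hx, mul_zero]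
          · exact fun j => hG.aestronglyMeasurable.enorm.mul
              (measurable_const.indicator measurableSet_ball).aemeasurable
      _ < ⊤ := by
          refine (lt_of_le_of_lt (ENNReal.tsum_le_tsum fun j => ?_) hsum).trans ENNReal.one_lt_top
          gcongr
          exact le_add_self

/-- If `|∫ h φ| ≤ ∫ G |φ|` for all test functions, then `|h| ≤ G` almost everywhere: test with
mollifiers centred at Lebesgue points. -/
lemma ae_abs_le_of_forall_abs_integral_le [μ.IsAddHaarMeasure] {h G : E → ℝ}
    (hh : LocallyIntegrable h μ) (hG : LocallyIntegrable G μ)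
    (hle : ∀ φ ∈ testFunctions E, |∫ x, h x * φ x ∂μ| ≤ ∫ x, G x * |φ x| ∂μ) :
    ∀ᵐ x ∂μ, |h x| ≤ G x := by
  filter_upwards [ae_tendsto_mollify μ hh, ae_tendsto_mollify μ hG] with x hx hGx
  refine le_of_tendsto_of_tendsto' hx.abs hGx fun k => ?_
  have hφ : (fun t => (mollifier E k).normed μ (x - t)) ∈ testFunctions E :=
    ⟨(mollifier E k).contDiff_normed.comp (contDiff_const.sub contDiff_id),
      (mollifier E k).hasCompactSupport_normed.comp_homeomorph (Homeomorph.subLeft x)⟩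
  have hswap : ∀ f : E → ℝ, mollify μ k f x = ∫ t, f t * (mollifier E k).normed μ (x - t) ∂μ := by
    intro f
    rw [mollify, convolution_eq_swap]
    simp [mul_comm]
  rw [hswap, hswap]
  refine (hle _ hφ).trans_eq ?_
  simp only [abs_of_nonneg (ContDiffBump.nonneg_normed _ _)]

/-- A linear functional on test functions dominated by the weighted `L¹` norm `∫ G |φ|` is
integration against a function `h` with `|h| ≤ G`. Dividing test functions by a weight `w` with
`∫ G w < ∞` embeds them in the Hilbert space `L²(G w)` of a finite measure, where the theorems of
Hahn–Banach and Riesz apply. -/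
lemma exists_eq_integral_of_abs_le [μ.IsAddHaarMeasure] {G : E → ℝ}
    (hG : LocallyIntegrable G μ) (hG0 : ∀ x, 0 ≤ G x) (T : testFunctions E →ₗ[ℝ] ℝ)
    (hT : ∀ φ, |T φ| ≤ ∫ x, G x * |(φ : E → ℝ) x| ∂μ) :
    ∃ h : E → ℝ, LocallyIntegrable h μ ∧ (∀ φ, T φ = ∫ x, h x * (φ : E → ℝ) x ∂μ) ∧
      ∀ᵐ x ∂μ, |h x| ≤ G x := by
  obtain ⟨w, hwm, hwc, hwi⟩ := exists_weight_integrable_mul hG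
  have hw0 : ∀ x, 0 < w x := by
    intro x
    obtain ⟨c, hc, hcw⟩ := hwc (‖x‖ + 1)
    exact hc.trans_le (hcw x (by simp))
  set ν := μ.withDensity fun x => ENNReal.ofReal (G x * w x) with hν
  have : IsFiniteMeasure ν := isFiniteMeasure_withDensity_ofReal hwi.2
  have hWm : AEMeasurable (fun x => ENNReal.ofReal (G x * w x)) μ :=
    hwi.aestronglyMeasurable.aemeasurable.ennreal_ofReal
  have hWr : ∀ x, (ENNReal.ofReal (G x * w x)).toReal = G x * w x := fun x =>
    ENNReal.toReal_ofReal (mul_nonneg (hG0 x) (hw0 x).le)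
  have hint : ∀ g : E → ℝ, ∫ x, g x ∂ν = ∫ x, G x * w x * g x ∂μ := by
    intro g
    rw [hν, integral_withDensity_eq_integral_toReal_smul₀ hWm (by simp)]
    simp only [hWr, smul_eq_mul]
  -- test functions are bounded and supported where the weight is bounded below
  have hmem : ∀ φ ∈ testFunctions E, ∀ p, MemLp (fun x => φ x * (w x)⁻¹) p ν := by
    intro φ hφ p
    obtain ⟨R, hR⟩ := hφ.2.isCompact.isBounded.subset_ball (0 : E)
    obtain ⟨c, hc, hcw⟩ := hwc R
    obtain ⟨C, hC⟩ := hφ.1.continuous.bounded_above_of_compact_support hφ.2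
    refine MemLp.of_bound ?_ (C * c⁻¹) (Eventually.of_forall fun x => ?_)
    · exact (hφ.1.continuous.measurable.mul hwm.inv).aestronglyMeasurable
    · by_cases hx : x ∈ tsupport φ
      · rw [norm_mul, norm_inv, Real.norm_of_nonneg (hw0 x).le]
        exact mul_le_mul (hC x) (inv_anti₀ hc (hcw x (hR hx))) (inv_nonneg.2 (hw0 x).le)
          ((norm_nonneg (φ x)).trans (hC x))
      · rw [image_eq_zero_of_notMem_tsupport hx, zero_mul, norm_zero]
        exact mul_nonneg ((norm_nonneg (φ x)).trans (hC x)) (by positivity)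
  let e : testFunctions E →ₗ[ℝ] Lp ℝ 2 ν :=
    { toFun := fun φ => (hmem φ φ.2 2).toLp _
      map_add' := by
        intro φ ψ
        rw [← MemLp.toLp_add]
        refine MemLp.toLp_congr _ _ (Eventually.of_forall fun x => ?_)
        simp [add_mul]
      map_smul' := by
        intro c φ
        rw [RingHom.id_apply, ← MemLp.toLp_const_smul]
        refine MemLp.toLp_congr _ _ (Eventually.of_forall fun x => ?_)
        simp [mul_assoc] }
  have hbound : ∃ C, ∀ φ, ‖T φ‖ ≤ C * ‖e φ‖ := by
    set K := ν univ ^ (1 / (1 : ℝ≥0∞).toReal - 1 / (2 : ℝ≥0∞).toReal) with hK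
    have hKt : K ≠ ⊤ := ENNReal.rpow_ne_top_of_nonneg (by norm_num) (measure_ne_top _ _)
    refine ⟨K.toReal, fun φ => ?_⟩
    have h1 : ∫ x, G x * |(φ : E → ℝ) x| ∂μ = ∫ x, ‖(φ : E → ℝ) x * (w x)⁻¹‖ ∂ν := by
      rw [hint]
      refine integral_congr_ae (Eventually.of_forall fun x => ?_)
      have := (hw0 x).ne'
      simp only [norm_mul, norm_inv, Real.norm_of_nonneg (hw0 x).le, Real.norm_eq_abs]
      field_simp
    have hL := hmem φ φ.2 2
    have h2 : eLpNorm (fun x => (φ : E → ℝ) x * (w x)⁻¹) 1 ν ≤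
        eLpNorm (fun x => (φ : E → ℝ) x * (w x)⁻¹) 2 ν * K :=
      eLpNorm_le_eLpNorm_mul_rpow_measure_univ (by norm_num) hL.1
    rw [Real.norm_eq_abs]
    refine (hT φ).trans ?_
    rw [h1, integral_norm_eq_lintegral_enorm hL.1, ← eLpNorm_one_eq_lintegral_enorm]
    refine (ENNReal.toReal_mono (ENNReal.mul_ne_top hL.2.ne hKt) h2).trans_eq ?_
    rw [ENNReal.toReal_mul, mul_comm]
    congr 1
    exact (Lp.norm_toLp _ hL).symm
  obtain ⟨Λ, hΛ, -⟩ := exists_extension_norm_eq e.range (T.compLeftInverse e)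
  have hΛe : ∀ φ, Λ (e φ) = T φ := by
    intro φ
    rw [← T.compLeftInverse_apply_of_bdd e hbound φ _ rfl]
    exact hΛ ⟨e φ, LinearMap.mem_range_self e φ⟩
  set k := (InnerProductSpace.toDual ℝ (Lp ℝ 2 ν)).symm Λ with hk
  have hrep : ∀ φ : testFunctions E, T φ = ∫ x, G x * k x * (φ : E → ℝ) x ∂μ := by
    intro φ
    rw [← hΛe, ← InnerProductSpace.toDual_symm_apply, L2.inner_def]
    have hcoe : ∀ᵐ x ∂ν, inner ℝ (k x) (e φ x) = k x * ((φ : E → ℝ) x * (w x)⁻¹) := by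
      filter_upwards [(hmem φ φ.2 2).coeFn_toLp] with x hx
      have : e φ x = (φ : E → ℝ) x * (w x)⁻¹ := hx
      rw [this]
      simp [mul_comm]
    rw [integral_congr_ae hcoe, hint]
    refine integral_congr_ae (Eventually.of_forall fun x => ?_)
    have := (hw0 x).ne'
    field_simp
  have hkint : Integrable (fun x => G x * w x * k x) μ := by
    have h1 : Integrable k ν := (Lp.memLp k).integrable (by norm_num)
    have h2 := (integrable_withDensity_iff_integrable_smul₀' hWm (by simp)).1 h1
    simpa only [hWr, smul_eq_mul] using h2
  have hloc : LocallyIntegrable (fun x => G x * k x) μ := by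
    rw [locallyIntegrable_iff]
    intro K hK
    obtain ⟨R, hR⟩ := hK.isBounded.subset_ball (0 : E)
    obtain ⟨c, hc, hcw⟩ := hwc R
    have h1 : IntegrableOn (fun x => G x * w x * k x * (w x)⁻¹) K μ := by
      refine Integrable.mul_bdd (c := c⁻¹) hkint.integrableOn hwm.inv.aestronglyMeasurable ?_
      filter_upwards [ae_restrict_mem hK.measurableSet] with x hx
      rw [norm_inv, Real.norm_of_nonneg (hw0 x).le]
      exact inv_anti₀ hc (hcw x (hR hx))
    refine h1.congr (Eventually.of_forall fun x => ?_)
    have := (hw0 x).ne'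
    field_simp
  refine ⟨_, hloc, hrep, ae_abs_le_of_forall_abs_integral_le hloc hG fun φ hφ => ?_⟩
  rw [← hrep ⟨φ, hφ⟩]
  exact hT ⟨φ, hφ⟩

end Representation

/-! ### Weak derivatives of functions with a Sobolev metric gradient -/

section HajlaszToSobolev

open Filter
open scoped Topology

variable {n : ℕ}

/-- Integrating difference quotients of `φ` against `f` amounts to integrating those of `f`
against `φ`, which the metric gradient controls. -/
lemma abs_integral_mul_fderiv_le {f g : EuclideanSpace ℝ (Fin n) → ℝ}
    (hf : LocallyIntegrable f volume) (hg : LocallyIntegrable g volume)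
    (hfg : IsSobolevMetricGradient f g) {v : EuclideanSpace ℝ (Fin n)} (hv : ‖v‖ = 1)
    {φ : EuclideanSpace ℝ (Fin n) → ℝ} (hφ : φ ∈ testFunctions (EuclideanSpace ℝ (Fin n))) :
    |∫ x, f x * fderiv ℝ φ x v| ≤ ∫ x, 2 * g x * |φ x| := by
  obtain ⟨hφd, hφs⟩ := hφ
  obtain ⟨-, -, N, hN, hfgN⟩ := hfg
  have hφc := hφd.continuous
  obtain ⟨C, hC⟩ := hφd.lipschitzWith_of_hasCompactSupport hφs (by simp)
  set K := Metric.cthickening 1 (tsupport φ) with hK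
  have hKc : IsCompact K := hφs.isCompact.cthickening
  have hsubK : tsupport φ ⊆ K := Metric.self_subset_cthickening _
  -- truncating `f` to a neighbourhood of `tsupport φ` changes no integral against difference
  -- quotients of `φ` with increments at most `1`, and makes it integrable
  set F := K.indicator f with hF
  have hFi : Integrable F volume :=
    (integrable_indicator_iff hKc.measurableSet).2 (hf.integrableOn_isCompact hKc)
  have hA := hC.integral_inv_smul_sub_mul_tendsto_integral_lineDeriv_mul hFi v
  have hlim : ∫ x, lineDeriv ℝ φ x v * F x = ∫ x, f x * fderiv ℝ φ x v := by
    refine integral_congr_ae (Eventually.of_forall fun x => ?_)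
    simp only [((hφd.differentiable (by simp)) x).lineDeriv_eq_fderiv]
    by_cases hx : x ∈ K
    · rw [hF, indicator_of_mem hx, mul_comm]
    · have : fderiv ℝ φ x = 0 :=
        image_eq_zero_of_notMem_tsupport fun h => hx (hsubK (tsupport_fderiv_subset ℝ h))
      simp [this]
  rw [hlim] at hA
  -- translates of test functions are integrable against locally integrable functions
  have htr : ∀ (ψ : EuclideanSpace ℝ (Fin n) → ℝ) (a : EuclideanSpace ℝ (Fin n)),
      LocallyIntegrable ψ volume → Integrable (fun x => ψ x * φ (x + a)) := by
    intro ψ a hψ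
    exact hψ.integrable_smul_right_of_hasCompactSupport (g := fun x => φ (x + a)) (by fun_prop)
      (hφs.comp_homeomorph (Homeomorph.addRight a))
  have hshift : ∀ (ψ : EuclideanSpace ℝ (Fin n) → ℝ) (a : EuclideanSpace ℝ (Fin n)),
      LocallyIntegrable ψ volume → Integrable (fun x => ψ (x - a) * φ x) := by
    intro ψ a hψ
    have := (htr ψ a hψ).comp_sub_right a
    simpa using this
  have hgabs : ∀ a : EuclideanSpace ℝ (Fin n),
      Integrable (fun x => g x * |φ (x + a)|) := by
    intro a
    exact hg.integrable_smul_right_of_hasCompactSupport (g := fun x => |φ (x + a)|) (by fun_prop)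
      ((hφs.comp_homeomorph (Homeomorph.addRight a)).abs)
  have hgshift : ∀ a : EuclideanSpace ℝ (Fin n),
      Integrable (fun x => g (x - a) * |φ x|) := by
    intro a
    have := (hgabs a).comp_sub_right a
    simpa using this
  set H : EuclideanSpace ℝ (Fin n) → ℝ := fun a => ∫ x, g x * |φ (x + a)| with hH
  have hbound : ∀ t : ℝ, t ∈ Ioo (0 : ℝ) 1 →
      |∫ x, (t⁻¹ • (φ (x + t • v) - φ x)) * F x| ≤ H (t • v) + H 0 := by
    intro t ht
    have hnorm : ‖t • v‖ = t := by rw [norm_smul, hv, mul_one, Real.norm_of_nonneg ht.1.le]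
    have h1 : ∫ x, (t⁻¹ • (φ (x + t • v) - φ x)) * F x =
        ∫ x, t⁻¹ * (f x * φ (x + t • v) - f x * φ x) := by
      refine integral_congr_ae (Eventually.of_forall fun x => ?_)
      by_cases hx : x ∈ K
      · simp only [hF, indicator_of_mem hx, smul_eq_mul]; ring
      · have h0 : φ x = 0 := image_eq_zero_of_notMem_tsupport fun h => hx (hsubK h)
        have h0' : φ (x + t • v) = 0 := by
          refine image_eq_zero_of_notMem_tsupport fun h => hx ?_
          refine Metric.mem_cthickening_of_dist_le x _ 1 _ h ?_
          rw [dist_eq_norm, sub_add_cancel_left, norm_neg, hnorm]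
          exact ht.2.le
        simp [h0, h0']
    have h2 : ∫ x, f x * φ (x + t • v) = ∫ x, f (x - t • v) * φ x := by
      rw [← integral_sub_right_eq_self _ (t • v)]
      simp
    have h3 : H (t • v) = ∫ x, g (x - t • v) * |φ x| := by
      simp only [hH]
      rw [← integral_sub_right_eq_self _ (t • v)]
      simp
    have hf0 : Integrable fun x => f x * φ x := by simpa using htr f 0 hf
    have hg0 : Integrable fun x => g x * |φ x| := by simpa using hgabs 0
    rw [h1, integral_const_mul, integral_sub (htr f _ hf) hf0, h2,
      ← integral_sub (hshift f _ hf) hf0, ← integral_const_mul, h3]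
    have hH0 : H 0 = ∫ x, g x * |φ x| := by simp [hH]
    rw [hH0, ← integral_add (hgshift _) hg0, ← Real.norm_eq_abs]
    refine norm_integral_le_of_norm_le ((hgshift _).add hg0) ?_
    have hN1 : ∀ᵐ x, x ∉ N := measure_eq_zero_iff_ae_notMem.1 hN
    have hN2 : ∀ᵐ x, x - t • v ∉ N :=
      (measurePreserving_sub_right volume (t • v)).quasiMeasurePreserving.ae hN1
    filter_upwards [hN1, hN2] with x hx1 hx2
    have hle := hfgN _ hx2 _ hx1
    rw [sub_sub_cancel_left, norm_neg, hnorm] at hle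
    rw [← sub_mul, norm_mul, norm_mul, norm_inv, Real.norm_of_nonneg ht.1.le, Real.norm_eq_abs,
      Real.norm_eq_abs, ← add_mul, ← mul_assoc]
    gcongr
    rw [inv_mul_le_iff₀ ht.1]
    exact hle
  have hHc : Continuous H := by
    have hcv : HasCompactSupport fun z => |φ (-z)| :=
      (hφs.comp_homeomorph (Homeomorph.neg _)).abs
    have := hcv.continuous_convolution_right (ContinuousLinearMap.lsmul ℝ ℝ) hg
      (by fun_prop : Continuous fun z => |φ (-z)|)
    have h2 := this.comp (continuous_neg)
    refine h2.congr fun a => ?_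
    simp [convolution_def, hH, sub_eq_add_neg, add_comm]
  have hHlim : Tendsto (fun t : ℝ => H (t • v) + H 0) (𝓝[>] 0) (𝓝 (H 0 + H 0)) := by
    have h1 : Continuous fun t : ℝ => H (t • v) + H 0 := by fun_prop
    have h2 := (h1.tendsto 0).mono_left (nhdsWithin_le_nhds (s := Ioi 0))
    simpa using h2
  have hfinal := le_of_tendsto_of_tendsto hA.abs hHlim
    (eventually_of_mem (Ioo_mem_nhdsGT zero_lt_one) hbound)
  refine hfinal.trans_eq ?_
  simp only [hH, add_zero, mul_assoc]
  rw [integral_const_mul]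
  ring

/-- A function with a locally integrable Sobolev metric gradient `g` has weak partial
derivatives bounded by `2 g`. -/
lemma exists_hasWeakPartial_of_isSobolevMetricGradient {f g : EuclideanSpace ℝ (Fin n) → ℝ}
    (hf : LocallyIntegrable f volume) (hg : LocallyIntegrable g volume)
    (hfg : IsSobolevMetricGradient f g) (i : Fin n) :
    ∃ h, HasWeakPartial i f h ∧ ∀ᵐ x, |h x| ≤ 2 * g x := by
  set v : EuclideanSpace ℝ (Fin n) := EuclideanSpace.single i 1 with hv
  have hint : ∀ φ ∈ testFunctions (EuclideanSpace ℝ (Fin n)),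
      Integrable fun x => f x * fderiv ℝ φ x v := by
    intro φ hφ
    have hd : Continuous fun x => fderiv ℝ φ x v :=
      (hφ.1.continuous_fderiv (by simp)).clm_apply continuous_const
    exact hf.integrable_smul_right_of_hasCompactSupport hd (hφ.2.fderiv_apply ℝ v)
  let T : testFunctions (EuclideanSpace ℝ (Fin n)) →ₗ[ℝ] ℝ :=
    { toFun := fun φ => -∫ x, f x * fderiv ℝ (φ : EuclideanSpace ℝ (Fin n) → ℝ) x v
      map_add' := by
        intro φ ψ
        rw [← neg_add, ← integral_add (hint φ φ.2) (hint ψ ψ.2)]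
        congr 2 with x
        have h1 := (φ.2.1.differentiable (by simp)) x
        have h2 := (ψ.2.1.differentiable (by simp)) x
        rw [Submodule.coe_add, fderiv_add h1 h2, add_apply, mul_add]
      map_smul' := by
        intro c φ
        rw [RingHom.id_apply, smul_neg, ← integral_smul]
        congr 2 with x
        have h1 := (φ.2.1.differentiable (by simp)) x
        rw [Submodule.coe_smul, fderiv_const_smul h1, smul_apply, smul_eq_mul,
          smul_eq_mul]
        ring }
  obtain ⟨h, hh, hT, hle⟩ := exists_eq_integral_of_abs_le (μ := volume)
    (G := fun x => 2 * g x) (hg.smul (2 : ℝ)) (fun x => mul_nonneg zero_le_two (hfg.1 x)) T (by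
      intro φ
      change |-∫ x, f x * fderiv ℝ (φ : EuclideanSpace ℝ (Fin n) → ℝ) x v| ≤ _
      rw [abs_neg]
      exact abs_integral_mul_fderiv_le hf hg hfg (by simp [hv]) φ.2)
  refine ⟨h, ⟨hf, hh, fun φ hφd hφs => ?_⟩, hle⟩
  have h1 : -∫ x, f x * fderiv ℝ φ x v = ∫ x, h x * φ x := hT ⟨φ, hφd, hφs⟩
  rw [← h1, neg_neg]

end HajlaszToSobolev

/-! ### Sobolev, Hajłasz and mean quotient classes -/

section Classes

open Filter

variable {n : ℕ}

lemma MemLpLoc.locallyIntegrable {p : ℝ≥0∞} (hp : 1 ≤ p) {f : EuclideanSpace ℝ (Fin n) → ℝ}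
    (hf : MemLpLoc f p) : LocallyIntegrable f volume := by
  rw [locallyIntegrable_iff]
  intro K hK
  have : IsFiniteMeasure (volume.restrict K) := isFiniteMeasure_restrict.2 hK.measure_lt_top.ne
  exact (hf K hK).integrable hp

lemma MeasureTheory.MemLp.memLpLoc {p : ℝ≥0∞} {f : EuclideanSpace ℝ (Fin n) → ℝ}
    (hf : MemLp f p volume) : MemLpLoc f p :=
  fun K _ => hf.restrict K

lemma MeasureTheory.MemLp.ennreal_toReal {α : Type*} [MeasurableSpace α] {μ : Measure α}
    {p : ℝ≥0∞} {u : α → ℝ≥0∞} (hu : MemLp u p μ) : MemLp (fun x => (u x).toReal) p μ := by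
  refine hu.of_le_enorm hu.1.aemeasurable.ennreal_toReal.aestronglyMeasurable
    (Eventually.of_forall fun x => ?_)
  rw [Real.enorm_of_nonneg ENNReal.toReal_nonneg, enorm_eq_self]
  exact ENNReal.ofReal_toReal_le

lemma ae_ne_top_of_memLp_restrict {p : ℝ≥0∞} (hp : 1 ≤ p)
    {u : EuclideanSpace ℝ (Fin n) → ℝ≥0∞}
    (hu : ∀ K, IsCompact K → MemLp u p (volume.restrict K)) : ∀ᵐ x, u x ≠ ⊤ := by
  have h1 : ∀ k : ℕ, ∀ᵐ x, x ∈ Metric.closedBall (0 : EuclideanSpace ℝ (Fin n)) k → u x ≠ ⊤ := by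
    intro k
    have hK := isCompact_closedBall (0 : EuclideanSpace ℝ (Fin n)) (k : ℝ)
    have : IsFiniteMeasure (volume.restrict (Metric.closedBall (0 : EuclideanSpace ℝ (Fin n)) k)) :=
      isFiniteMeasure_restrict.2 hK.measure_lt_top.ne
    have h2 := (hu _ hK).mono_exponent hp
    rw [← ae_restrict_iff' measurableSet_closedBall]
    have h3 := h2.2.ne
    rw [eLpNorm_one_eq_lintegral_enorm] at h3
    exact (ae_lt_top' h2.1.aemeasurable h3).mono fun x hx => hx.ne
  filter_upwards [ae_all_iff.2 h1] with x hx
  obtain ⟨k, hk⟩ := exists_nat_ge ‖x‖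
  exact hx k (by simpa using hk)

/-- The maximal function with radii at most `1` only sees `u` at distance less than `1`, so the
maximal theorem localizes. -/
lemma memLp_restrict_maximalAverage {p : ℝ≥0∞} (hp : 1 < p)
    {u : EuclideanSpace ℝ (Fin n) → ℝ≥0∞}
    (hu : ∀ K, IsCompact K → MemLp u p (volume.restrict K))
    (K : Set (EuclideanSpace ℝ (Fin n))) (hK : IsCompact K) :
    MemLp (maximalAverage volume (Ioc 0 1) u) p (volume.restrict K) := by
  have hK1 : IsCompact (Metric.cthickening 1 K) := hK.cthickening
  have h1 : MemLp ((Metric.cthickening 1 K).indicator u) p volume :=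
    (memLp_indicator_iff_restrict hK1.measurableSet).2 (hu _ hK1)
  have h2 := (memLp_maximalAverage Ioc_subset_Ioi_self hp h1 (S := Ioc 0 1)).restrict K
  refine h2.ae_eq ?_
  filter_upwards [ae_restrict_mem hK.measurableSet] with x hx
  refine biSup_congr fun r hr => ?_
  rw [ballAverage, ballAverage]
  congr 1
  refine setLIntegral_congr_fun measurableSet_ball fun z hz => indicator_of_mem ?_ u
  exact Metric.mem_cthickening_of_dist_le z x 1 K hx ((Metric.mem_ball.1 hz).le.trans hr.2)

/-- Weak gradients give Sobolev metric gradients: at distances at most `1` by the maximal function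
of the gradient, and at larger distances trivially by `|f|`. -/
lemma isSobolevMetricGradient_of_hasWeakPartial {f : EuclideanSpace ℝ (Fin n) → ℝ}
    {h : Fin n → EuclideanSpace ℝ (Fin n) → ℝ} (hfh : ∀ i, HasWeakPartial i f (h i))
    (hf : LocallyIntegrable f volume)
    (hM : ∀ᵐ z, maximalAverage volume (Ioc 0 1) (fun z => ∑ i, ‖h i z‖ₑ) z ≠ ⊤)
    (hMi : LocallyIntegrable
      (fun z => (maximalAverage volume (Ioc 0 1) (fun z => ∑ i, ‖h i z‖ₑ) z).toReal) volume) :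
    IsSobolevMetricGradient f fun x => |f x| +
      2 ^ n * (maximalAverage volume (Ioc 0 1) (fun z => ∑ i, ‖h i z‖ₑ) x).toReal := by
  obtain ⟨N, hN, hle⟩ := exists_null_enorm_sub_le_maximalAverage hfh 1 hM hMi hf
  set M := maximalAverage volume (Ioc 0 1) (fun z => ∑ i, ‖h i z‖ₑ) with hMdef
  refine ⟨fun x => by positivity, ?_, N ∪ {x | M x = ⊤}, ?_, ?_⟩
  · exact hf.aestronglyMeasurable.norm.add
      ((measurable_maximalAverage _ _).ennreal_toReal.const_mul _).aestronglyMeasurable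
  · refine measure_union_null hN ?_
    simpa [ae_iff] using hM
  · intro x hx y hy
    simp only [mem_union, not_or, mem_ofPred_eq] at hx hy
    have hMx : 0 ≤ (M x).toReal := ENNReal.toReal_nonneg
    have hMy : 0 ≤ (M y).toReal := ENNReal.toReal_nonneg
    rcases le_or_gt ‖x - y‖ 1 with h1 | h1
    · have h2 := ENNReal.toReal_mono (by finiteness [hx.2, hy.2]) (hle x hx.1 y hy.1 h1)
      rw [toReal_enorm, ENNReal.toReal_mul, ENNReal.toReal_mul, toReal_enorm,
        ENNReal.toReal_add hx.2 hy.2, ENNReal.toReal_pow, ENNReal.toReal_ofNat,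
        Real.norm_eq_abs] at h2
      calc |f x - f y| ≤ ‖x - y‖ * (2 ^ n * (M x).toReal + 2 ^ n * (M y).toReal) := by
            linarith
        _ ≤ _ := by
            gcongr
            · linarith [abs_nonneg (f x)]
            · linarith [abs_nonneg (f y)]
    · calc |f x - f y| ≤ 1 * (|f x| + |f y|) := by rw [one_mul]; exact abs_sub _ _
        _ ≤ _ := by
            gcongr
            · linarith [mul_nonneg (pow_nonneg zero_le_two n) hMx]
            · linarith [mul_nonneg (pow_nonneg zero_le_two n) hMy]

lemma MemSobolevWLoc.memHajlaszLoc {p : ℝ≥0∞} (hp : 1 < p) {f : EuclideanSpace ℝ (Fin n) → ℝ}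
    (hf : MemSobolevWLoc f p) : MemHajlaszLoc f p := by
  obtain ⟨hf, hW⟩ := hf
  choose h hh hfh using hW
  have hu : ∀ K, IsCompact K → MemLp (fun z => ∑ i, ‖h i z‖ₑ) p (volume.restrict K) :=
    fun K hK => memLp_finsetSum _ fun i _ => (hh i K hK).enorm
  have hML := memLp_restrict_maximalAverage hp hu
  have hMr : MemLpLoc (fun z =>
      (maximalAverage volume (Ioc 0 1) (fun z => ∑ i, ‖h i z‖ₑ) z).toReal) p :=
    fun K hK => (hML K hK).ennreal_toReal
  refine ⟨hf, _, isSobolevMetricGradient_of_hasWeakPartial hfh (hf.locallyIntegrable hp.le)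
    (ae_ne_top_of_memLp_restrict hp.le hML) (hMr.locallyIntegrable hp.le), fun K hK => ?_⟩
  exact (hf K hK).abs.add ((hMr K hK).const_mul _)

lemma MemSobolevW.memHajlasz {p : ℝ≥0∞} (hp : 1 < p) {f : EuclideanSpace ℝ (Fin n) → ℝ}
    (hf : MemSobolevW f p) : MemHajlasz f p := by
  obtain ⟨hf, hW⟩ := hf
  choose h hh hfh using hW
  have hu : MemLp (fun z => ∑ i, ‖h i z‖ₑ) p volume :=
    memLp_finsetSum _ fun i _ => (hh i).enorm
  have hML := memLp_maximalAverage Ioc_subset_Ioi_self hp hu (S := Ioc 0 1)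
  have hMr := hML.ennreal_toReal
  refine ⟨hf.memLpLoc, _, isSobolevMetricGradient_of_hasWeakPartial hfh
    (hf.memLpLoc.locallyIntegrable hp.le)
    (ae_ne_top_of_memLp_restrict hp.le fun K _ => hML.restrict K)
    (hMr.memLpLoc.locallyIntegrable hp.le), ?_⟩
  exact hf.abs.add (hMr.const_mul _)

lemma MemHajlaszLoc.memSobolevWLoc {p : ℝ≥0∞} (hp : 1 ≤ p) {f : EuclideanSpace ℝ (Fin n) → ℝ}
    (hf : MemHajlaszLoc f p) : MemSobolevWLoc f p := by
  obtain ⟨hf, g, hfg, hg⟩ := hf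
  refine ⟨hf, fun i => ?_⟩
  obtain ⟨h, hh, hle⟩ := exists_hasWeakPartial_of_isSobolevMetricGradient
    (hf.locallyIntegrable hp) (hg.locallyIntegrable hp) hfg i
  refine ⟨h, fun K hK => ((hg K hK).const_mul 2).mono' hh.2.1.aestronglyMeasurable.restrict ?_, hh⟩
  exact ae_restrict_of_ae hle

lemma MemHajlasz.memSobolevW {p : ℝ≥0∞} (hp : 1 ≤ p) {f : EuclideanSpace ℝ (Fin n) → ℝ}
    (hf : MemLp f p volume) (hfM : MemHajlasz f p) : MemSobolevW f p := by
  obtain ⟨-, g, hfg, hg⟩ := hfM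
  refine ⟨hf, fun i => ?_⟩
  obtain ⟨h, hh, hle⟩ := exists_hasWeakPartial_of_isSobolevMetricGradient
    (hf.memLpLoc.locallyIntegrable hp) (hg.memLpLoc.locallyIntegrable hp) hfg i
  exact ⟨h, (hg.const_mul 2).mono' hh.2.1.aestronglyMeasurable hle, hh⟩

lemma MemMQ.memHajlasz {p : ℝ≥0∞} (hp : 1 ≤ p) {f : EuclideanSpace ℝ (Fin n) → ℝ}
    (hf : MemMQ f p) : MemHajlasz f p := by
  obtain ⟨hf, hQ⟩ := hf
  refine ⟨hf.memLpLoc, fun x => 2 ^ n * (maximalMeanQuotient f x).toReal, ⟨fun x => ?_, ?_,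
    {x | maximalMeanQuotient f x = ⊤}, ?_, ?_⟩, hQ.ennreal_toReal.const_mul _⟩
  · exact mul_nonneg (by positivity) ENNReal.toReal_nonneg
  · exact (hQ.ennreal_toReal.const_mul _).1
  · simpa [ae_iff] using ae_ne_top_of_memLp_restrict hp fun K _ => hQ.restrict K
  · intro x hx y hy
    rw [mem_ofPred_eq] at hx hy
    rcases eq_or_ne x y with rfl | hxy
    · simp
    have hr : 0 < ‖x - y‖ := norm_pos_iff.2 (sub_ne_zero.2 hxy)
    have hQle : ∀ w, meanQuotient f ‖x - y‖ w ≤ maximalMeanQuotient f w := fun w =>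
      le_iSup₂ (f := fun (r : ℝ) (_ : 0 < r) => meanQuotient f r w) _ hr
    have h1 : ‖f x - f y‖ₑ ≤ 2 ^ n * ‖x - y‖ₑ *
        (maximalMeanQuotient f x + maximalMeanQuotient f y) :=
      (enorm_sub_le_meanQuotient hf.1.aemeasurable x y).trans
        (mul_le_mul_right (add_le_add (hQle x) (hQle y)) _)
    have h2 := ENNReal.toReal_mono (by finiteness) h1
    rw [toReal_enorm, ENNReal.toReal_mul, ENNReal.toReal_mul, toReal_enorm,
      ENNReal.toReal_add hx hy, ENNReal.toReal_pow, ENNReal.toReal_ofNat,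
      Real.norm_eq_abs] at h2
    linarith

/-- If `g` is a Sobolev metric gradient of `f`, then `MQ f ≤ M g + g` almost everywhere. -/
lemma ae_maximalMeanQuotient_le {f g : EuclideanSpace ℝ (Fin n) → ℝ}
    (hfg : IsSobolevMetricGradient f g) :
    ∀ᵐ x, maximalMeanQuotient f x ≤ maximalAverage volume (Ioi 0) (fun z => ‖g z‖ₑ) x + ‖g x‖ₑ := by
  obtain ⟨-, -, N, hN, hle⟩ := hfg
  have hN1 : ∀ᵐ x, x ∉ N := measure_eq_zero_iff_ae_notMem.1 hN
  filter_upwards [hN1] with x hx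
  have hq : ∀ᵐ z, ‖f z - f x‖ₑ / ‖z - x‖ₑ ≤ ‖g z‖ₑ + ‖g x‖ₑ := by
    filter_upwards [hN1] with z hz
    refine ENNReal.div_le_of_le_mul ?_
    have h1 : ‖f z - f x‖ ≤ ‖(‖g z‖ + ‖g x‖) * ‖z - x‖‖ := by
      rw [Real.norm_of_nonneg (by positivity : 0 ≤ (‖g z‖ + ‖g x‖) * ‖z - x‖), mul_comm]
      refine (hle z hz x hx).trans ?_
      gcongr
      · exact Real.le_norm_self _
      · exact Real.le_norm_self _
    refine (enorm_le_iff_norm_le.2 h1).trans ?_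
    rw [enorm_mul, enorm_norm]
    gcongr
    refine (enorm_add_le _ _).trans ?_
    rw [enorm_norm, enorm_norm]
  rw [maximalMeanQuotient_eq]
  refine iSup₂_le fun r hr => ?_
  refine (ballAverage_mono_ae hq r x).trans ((ballAverage_add_const_le _ r x).trans ?_)
  gcongr
  exact ballAverage_le_maximalAverage hr _ x

lemma MemHajlasz.memMQ {p : ℝ≥0∞} (hp : 1 < p) {f : EuclideanSpace ℝ (Fin n) → ℝ}
    (hf : MemLp f p volume) (hfM : MemHajlasz f p) : MemMQ f p := by
  obtain ⟨-, g, hfg, hg⟩ := hfM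
  refine ⟨hf, ?_⟩
  have h1 := (memLp_maximalAverage Subset.rfl hp hg.enorm).add hg.enorm
  refine h1.of_le_enorm (aemeasurable_maximalMeanQuotient hf.1.aemeasurable).aestronglyMeasurable ?_
  filter_upwards [ae_maximalMeanQuotient_le hfg] with x hx
  simpa using hx

end Classes

theorem proposition3 (n : ℕ) (hn : 1 ≤ n) (p : ℝ≥0∞) (hp : 1 < p)
    (f : EuclideanSpace ℝ (Fin n) → ℝ) :
    (MemSobolevW f p ↔ MemLp f p volume ∧ MemHajlasz f p) ∧
    (MemSobolevWLoc f p ↔ MemHajlaszLoc f p) ∧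
    (MemMQ f p ↔ MemLp f p volume ∧ MemHajlasz f p) :=
  ⟨⟨fun h => ⟨h.1, h.memHajlasz hp⟩, fun h => h.2.memSobolevW hp.le h.1⟩,
    ⟨fun h => h.memHajlaszLoc hp, fun h => h.memSobolevWLoc hp.le⟩,
    ⟨fun h => ⟨h.1, h.memHajlasz hp.le⟩, fun h => h.2.memMQ hp h.1⟩⟩
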